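/- Let $\mathsf h$ be a separable complex Hilbert space, let $\theta$ be an anti-unitary operator on $\mathsf h$ with $\theta^2=1$, and let $\Theta(x)=\theta x^*\theta$ for $x\in\mathcal B(\mathsf h)$. A quantum Markov semigroup (QMS) here means a norm-continuous one-parameter semigroup $(\mathcal T_t)_{t\ge0}$ of normal, completely positive, identity preserving linear maps on $\mathcal B(\mathsf h)$; $\mathcal T_{*t}$ denotes the predual map on the trace class operators, $\operatorname{tr}(\mathcal T_{*t}(\sigma)x)=\operatorname{tr}(\sigma\mathcal T_t(x))$. Let $\mathcal T$ be a QMS with a faithful invariant state $\rho$ such that $\overline{\operatorname{Im}(\rho^{1/2})}=\mathsf h$, and suppose that $\mathcal T$ has a $\Theta$-KMS adjoint, that is, a QMS $\mathcal T^\Theta$ with $$\operatorname{tr}\big(\rho^{1/2}\Theta(x^*)\rho^{1/2}\mathcal T_t(y)\big)=\operatorname{tr}\big(\rho^{1/2}\Theta(\mathcal T^\Theta_t(x^*))\rho^{1/2}y\big)\qquad (x,y\in\mathcal B(\mathsf h),\ t\ge0).$$ $\mathcal T$ satisfies $\Theta$-standard quantum detailed balance ($\Theta$-SQDB) if there is a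 QMS $\mathcal T'$ with $\operatorname{tr}(\rho^{1/2}x\rho^{1/2}\mathcal T_t(y))=\operatorname{tr}(\rho^{1/2}\mathcal T'_t(x)\rho^{1/2}y)$ for all $x,y\in\mathcal B(\mathsf h)$, $t\ge 0$ (a KMS adjoint) and $\mathcal T'_t=\Theta\circ\mathcal T_t\circ\Theta$ for all $t\ge0$. Fix any orthonormal basis $(e_i)_i$ of $\mathsf h$. For a bounded completely positive map $\Phi_*$ on the trace class operators, the $\rho$-Choi–Jamiołkowski operator $\mathcal J_\rho(\Phi_*)$ is the bounded operator on $\mathsf h\otimes\mathsf h$ with $$\langle e_k\otimes e_l,\ \mathcal J_\rho(\Phi_*)\,e_{k'}\otimes e_{l'}\rangle=\big\langle e_l,\ \Phi_*\big(|\rho^{1/2}e_k\rangle\langle\rho^{1/2}e_{k'}|\big)e_{l'}\big\rangle .$$ For states $\eta,\sigma$ let $S(\eta,\sigma)=\operatorname{tr}(\eta\log\eta-\eta\log\sigma)\in[0,\infty]$ if $\ker\sigma\subset\ker\eta$ (the trace being computed in an orthonormal basis of eigenvectors of $\eta$, with $\log\sigma$ understood as a quadratic form), and $S(\eta,\sigma)=\infty$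 otherwise. Then the following are equivalent: (i) $\mathcal T$ satisfies $\Theta$-SQDB; (ii) $S\big(\mathcal J_\rho(\mathcal T_{*t}),\mathcal J_\rho(\mathcal T^\Theta_{*t})\big)=0$ for all $t\ge0$. Consequently, if $\mathcal T$ satisfies $\Theta$-SQDB, then $t\mapsto S\big(\mathcal J_\rho(\mathcal T_{*t}),\mathcal J_\rho(\mathcal T^\Theta_{*t})\big)$ is finite for all $t\ge0$ and has right derivative $0$ at $t=0$, i.e. the entropy production rate $$e_p(\mathcal T_*,\rho)=\frac{d}{dt}S\big(\mathcal J_\rho(\mathcal T_{*t}),\mathcal J_\rho(\mathcal T^\Theta_{*t})\big)\Big|_{t=0}$$ exists and equals $0$. -/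

import Mathlib

open scoped NNReal ENNReal InnerProductSpace TensorProduct CStarAlgebra
open InnerProductSpace (rankOne)

noncomputable section

namespace QuantumMarkov

universe u

/-! ### Trace class operators and the trace -/

section Trace

variable (H : Type u) [NormedAddCommGroup H] [InnerProductSpace ℂ H] [CompleteSpace H]

/-- The index set of a chosen orthonormal (Hilbert) basis of the Hilbert space `H`. -/
def basisIndex : Set H := (exists_hilbertBasis ℂ H).choose

/-- A chosen orthonormal (Hilbert) basis of `H`. It is used to write down traces; the trace of a
trace class operator does not depend on this choice. -/
def stdBasis : HilbertBasis (basisIndex H) ℂ H :=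
  (exists_hilbertBasis ℂ H).choose_spec.choose

variable {H}

/-- `A` is a trace class operator: `tr |A| < ∞`, where `|A| = (A* A)^{1/2}`. -/
def IsTraceClass (A : H →L[ℂ] H) : Prop :=
  Summable fun i => ⟪stdBasis H i, CFC.abs A (stdBasis H i)⟫_ℂ

/-- The trace `tr A = ∑ᵢ ⟨bᵢ, A bᵢ⟩`. -/
def trace (A : H →L[ℂ] H) : ℂ :=
  ∑' i, ⟪stdBasis H i, A (stdBasis H i)⟫_ℂ

variable (H) in
/-- The space `L₁(H)` of trace class operators. -/
abbrev TraceClass : Type u := {A : H →L[ℂ] H // IsTraceClass A}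

/-- `|u⟩⟨v|` is trace class. -/
theorem isTraceClass_rankOne (u v : H) : IsTraceClass (rankOne ℂ u v) := by
  rcases eq_or_ne v 0 with rfl | hv
  · simp [IsTraceClass]
  have hv' : ‖v‖ ≠ 0 := norm_ne_zero_iff.mpr hv
  have habs : CFC.abs (rankOne ℂ u v) = ((‖u‖ / ‖v‖ : ℝ) : ℂ) • rankOne ℂ v v := by
    have hpos : (0 : H →L[ℂ] H) ≤ ((‖u‖ / ‖v‖ : ℝ) : ℂ) • rankOne ℂ v v := by
      rw [ContinuousLinearMap.nonneg_iff_isPositive]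
      refine (InnerProductSpace.isPositive_rankOne_self v).smul_of_nonneg ?_
      exact_mod_cast div_nonneg (norm_nonneg u) (norm_nonneg v)
    rw [CFC.abs]
    refine CFC.sqrt_unique ?_ hpos
    ext x
    have h2 : (‖v‖ : ℂ) ≠ 0 := by exact_mod_cast hv'
    simp only [ContinuousLinearMap.star_eq_adjoint, mul_apply_eq_comp,
      InnerProductSpace.adjoint_rankOne, InnerProductSpace.rankOne_apply, smul_apply,
      inner_self_eq_norm_sq_to_K, smul_smul, map_smul]
    congr 1
    push_cast
    field_simp
    simp
    ring
  unfold IsTraceClass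
  rw [habs]
  have hs := ((stdBasis H).summable_inner_mul_inner v v).mul_left ((‖u‖ / ‖v‖ : ℝ) : ℂ)
  refine hs.congr fun i => ?_
  simp [InnerProductSpace.rankOne_apply]

/-- A state: a positive operator of trace one. -/
def IsState (ρ : H →L[ℂ] H) : Prop :=
  0 ≤ ρ ∧ IsTraceClass ρ ∧ trace ρ = 1

/-- A state `ρ` is faithful if `tr(ρ x) = 0` with `x ≥ 0` forces `x = 0`. -/
def IsFaithful (ρ : H →L[ℂ] H) : Prop :=
  ∀ x : H →L[ℂ] H, 0 ≤ x → trace (ρ * x) = 0 → x = 0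

end Trace

/-! ### Quantum Markov semigroups -/

section QMS

variable {H : Type u} [NormedAddCommGroup H] [InnerProductSpace ℂ H] [CompleteSpace H]

/-- A bounded linear map on `B(H)` is completely positive: each amplification to `k × k` matrices
over `B(H)` preserves positivity. -/
def IsCompletelyPositive (Φ : (H →L[ℂ] H) →L[ℂ] (H →L[ℂ] H)) : Prop :=
  ∃ Ψ : (H →L[ℂ] H) →CP (H →L[ℂ] H), ∀ x, Ψ x = Φ x

/-- `Φ_*` is a predual of `Φ`: a map on `L₁(H)` with `tr(Φ_*(σ) x) = tr(σ Φ(x))` for all `σ`, `x`.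
There is at most one such map, and it is linear. -/
def IsPredual (Φ : (H →L[ℂ] H) →L[ℂ] (H →L[ℂ] H)) (Φs : TraceClass H → TraceClass H) : Prop :=
  ∀ (σ : TraceClass H) (x : H →L[ℂ] H), trace ((Φs σ : H →L[ℂ] H) * x) = trace (σ.1 * Φ x)

/-- `Φ` is normal (σ-weakly continuous): every normal functional `x ↦ tr(σ Φ(x))`, `σ ∈ L₁(H)`, is
again of the form `x ↦ tr(τ x)` with `τ ∈ L₁(H)`; in other words `Φ` has a predual map. -/
def IsNormal (Φ : (H →L[ℂ] H) →L[ℂ] (H →L[ℂ] H)) : Prop :=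
  ∃ Φs : TraceClass H → TraceClass H, IsPredual Φ Φs

variable (H) in
/-- A uniformly continuous quantum Markov semigroup on `B(H)`. -/
structure QMS where
  /-- the maps `T_t` -/
  map : ℝ≥0 → ((H →L[ℂ] H) →L[ℂ] (H →L[ℂ] H))
  map_zero : map 0 = ContinuousLinearMap.id ℂ (H →L[ℂ] H)
  map_add : ∀ s t, map (s + t) = (map s).comp (map t)
  completelyPositive : ∀ t, IsCompletelyPositive (map t)
  normal : ∀ t, IsNormal (map t)
  unital : ∀ t, map t 1 = 1
  continuous : Continuous map

/-- The predual map `T_{*t}` on `L₁(H)`. -/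
def QMS.predual (T : QMS H) (t : ℝ≥0) : TraceClass H → TraceClass H := (T.normal t).choose

/-- `ρ` is invariant: `tr(ρ T_t(x)) = tr(ρ x)`, that is `T_{*t}(ρ) = ρ`. -/
def IsInvariantState (ρ : H →L[ℂ] H) (T : QMS H) : Prop :=
  ∀ t (x : H →L[ℂ] H), trace (ρ * T.map t x) = trace (ρ * x)

/-- The reversing operation `Θ(x) = θ x* θ` of an anti-unitary operator `θ`. -/
def reversing (θ : H ≃ₗᵢ⋆[ℂ] H) (x : H →L[ℂ] H) : H →L[ℂ] H :=
  ((θ.toContinuousLinearEquiv : H →L⋆[ℂ] H).comp (ContinuousLinearMap.adjoint x)).comp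
    (θ.toContinuousLinearEquiv : H →L⋆[ℂ] H)

/-- `T'` is the KMS adjoint of `T`:
`tr(ρ^{1/2} x ρ^{1/2} T_t(y)) = tr(ρ^{1/2} T'_t(x) ρ^{1/2} y)`. -/
def IsKMSAdjoint (ρ : H →L[ℂ] H) (T T' : QMS H) : Prop :=
  ∀ t (x y : H →L[ℂ] H),
    trace (CFC.sqrt ρ * x * CFC.sqrt ρ * T.map t y) =
      trace (CFC.sqrt ρ * T'.map t x * CFC.sqrt ρ * y)

/-- `TΘ` is the `Θ`-KMS adjoint of `T`:
`tr(ρ^{1/2} Θ(x*) ρ^{1/2} T_t(y)) = tr(ρ^{1/2} Θ(TΘ_t(x*)) ρ^{1/2} y)`. -/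
def IsThetaKMSAdjoint (θ : H ≃ₗᵢ⋆[ℂ] H) (ρ : H →L[ℂ] H) (T TΘ : QMS H) : Prop :=
  ∀ t (x y : H →L[ℂ] H),
    trace (CFC.sqrt ρ * reversing θ (ContinuousLinearMap.adjoint x) * CFC.sqrt ρ * T.map t y) =
      trace (CFC.sqrt ρ * reversing θ (TΘ.map t (ContinuousLinearMap.adjoint x)) *
        CFC.sqrt ρ * y)

/-- `Θ`-standard quantum detailed balance: `T` has a KMS adjoint semigroup `T'`, and
`T'_t = Θ ∘ T_t ∘ Θ` for all `t`. -/
def ThetaSQDB (θ : H ≃ₗᵢ⋆[ℂ] H) (ρ : H →L[ℂ] H) (T : QMS H) : Prop :=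
  ∃ T' : QMS H, IsKMSAdjoint ρ T T' ∧
    ∀ t (x : H →L[ℂ] H), T'.map t x = reversing θ (T.map t (reversing θ x))

end QMS

/-! ### The Choi-Jamiolkowski operator -/

section Choi

variable {H : Type u} [NormedAddCommGroup H] [InnerProductSpace ℂ H] [CompleteSpace H]

variable (H) in
/-- The Hilbert space tensor product `H ⊗ H`. -/
abbrev HilbertTensor : Type u := UniformSpace.Completion (H ⊗[ℂ] H)

/-- The simple tensor `u ⊗ v` in the Hilbert space `H ⊗ H`. -/
def simpleTensor (u v : H) : HilbertTensor H := ((u ⊗ₜ[ℂ] v : H ⊗[ℂ] H) : HilbertTensor H)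

/-- `J` is the bounded operator of the sesquilinear form given on the orthonormal basis
`e_k ⊗ e_l` by `⟨e_k ⊗ e_l, J (e_k' ⊗ e_l')⟩ = ⟨e_l, Φ_*(|ρ^{1/2} e_k⟩⟨ρ^{1/2} e_k'|) e_l'⟩`,
that is `J = (1 ⊗ Φ_*)(ω_ρ)` with
`ω_ρ = ∑ |e_k⟩⟨e_k'| ⊗ ρ^{1/2} |e_k⟩⟨e_k'| ρ^{1/2}`. -/
def IsChoiJamiolkowski {ι : Type*} (e : HilbertBasis ι ℂ H) (ρ : H →L[ℂ] H)
    (Φs : TraceClass H → TraceClass H) (J : HilbertTensor H →L[ℂ] HilbertTensor H) : Prop :=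
  ∀ k l k' l' : ι,
    ⟪simpleTensor (e k) (e l), J (simpleTensor (e k') (e l'))⟫_ℂ =
      ⟪e l, (Φs ⟨rankOne ℂ (CFC.sqrt ρ (e k)) (CFC.sqrt ρ (e k')),
        isTraceClass_rankOne _ _⟩ : H →L[ℂ] H) (e l')⟫_ℂ

open Classical in
/-- The `ρ`-Choi-Jamiolkowski operator `J_ρ(Φ_*)` with respect to the orthonormal basis `e`: the
unique bounded operator with the above matrix elements. (It exists for every bounded completely
positive `Φ_*`; the value `0` for other maps plays no role.) -/
def choiJamiolkowski {ι : Type*} (e : HilbertBasis ι ℂ H) (ρ : H →L[ℂ] H)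
    (Φs : TraceClass H → TraceClass H) : HilbertTensor H →L[ℂ] HilbertTensor H :=
  if h : ∃ J, IsChoiJamiolkowski e ρ Φs J then h.choose else 0

end Choi

/-! ### Von Neumann relative entropy -/

section Entropy

variable {K : Type u} [NormedAddCommGroup K] [InnerProductSpace ℂ K] [CompleteSpace K]

/-- The eigenspace `{x | A x = a x}` of a bounded operator for the real number `a`. -/
abbrev eigen (A : K →L[ℂ] K) (a : ℝ) : Submodule ℂ K :=
  Module.End.eigenspace (A : K →ₗ[ℂ] K) (a : ℂ)

instance instCompleteSpaceEigen (A : K →L[ℂ] K) (a : ℝ) : CompleteSpace (eigen A a) := by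
  have h : (eigen A a : Set K) = {x | A x = (a : ℂ) • x} := by
    ext x
    simp [eigen]
  have hc : IsClosed (eigen A a : Set K) := by
    rw [h]
    exact isClosed_eq (by fun_prop) (by fun_prop)
  exact hc.completeSpace_coe

/-- The value `⟨φ, (-log σ) φ⟩ = ∑_b ‖P_b φ‖² (-log b)` of the quadratic form of the positive,
possibly unbounded, operator `-log σ`, for a state `σ = ∑_b b P_b` (so all `b ≤ 1`) and a vector `φ`
orthogonal to `ker σ`. -/
def negLogForm (σ : K →L[ℂ] K) (φ : K) : ℝ≥0∞ :=
  ∑' b : ℝ, ENNReal.ofReal (‖(eigen σ b).starProjection φ‖ ^ 2) * ENNReal.ofReal (-Real.log b)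

/-- Indices of an orthonormal basis of eigenvectors of `η`: an eigenvalue `a` and an element of the
index set of an orthonormal basis of its eigenspace. -/
abbrev EigenIndex (η : K →L[ℂ] K) : Type u :=
  Σ a : ℝ, basisIndex (eigen η a)

/-- The diagonal entry `⟨φ, (η log η - η log σ) φ⟩ = a log a + a ⟨φ, (-log σ) φ⟩` at the unit
eigenvector `φ` of `η` with eigenvalue `a` (where `0 log 0 = 0`). -/
def entropyTerm (η σ : K →L[ℂ] K) (p : EigenIndex η) : EReal :=
  ((p.1 * Real.log p.1 : ℝ) : EReal) +
    ((ENNReal.ofReal p.1 * negLogForm σ (stdBasis (eigen η p.1) p.2 : K) : ℝ≥0∞) : EReal)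

open Classical in
/-- Von Neumann relative entropy of the states `η`, `σ`: the trace of `η log η - η log σ`, computed in
an orthonormal basis of eigenvectors of `η`, if `ker σ ⊆ ker η`, and `∞` otherwise. The trace is the
sum of the positive parts of the diagonal entries minus the sum of their negative parts; for states
the latter sum is finite. -/
def relEntropy (η σ : K →L[ℂ] K) : EReal :=
  if LinearMap.ker (σ : K →ₗ[ℂ] K) ≤ LinearMap.ker (η : K →ₗ[ℂ] K) then
    ((∑' p : EigenIndex η, (entropyTerm η σ p).toENNReal : ℝ≥0∞) : EReal) -
      ((∑' p : EigenIndex η, (-entropyTerm η σ p).toENNReal : ℝ≥0∞) : EReal)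
  else ⊤

end Entropy

section Rate

variable {H : Type u} [NormedAddCommGroup H] [InnerProductSpace ℂ H] [CompleteSpace H]

/-- The relative entropy `S(J_ρ(T_{*t}), J_ρ(TΘ_{*t}))`. -/
def choiEntropy {ι : Type*} (e : HilbertBasis ι ℂ H) (ρ : H →L[ℂ] H) (T TΘ : QMS H) (t : ℝ≥0) :
    EReal :=
  relEntropy (choiJamiolkowski e ρ (T.predual t)) (choiJamiolkowski e ρ (TΘ.predual t))

/-- `r` is the entropy production rate `e_p(T_*, ρ)`: the relative entropy
`S(J_ρ(T_{*t}), J_ρ(TΘ_{*t}))` is finite for all `t ≥ 0` and has the (right) derivative `r`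
at `t = 0`. -/
def IsEntropyProductionRate {ι : Type*} (e : HilbertBasis ι ℂ H) (ρ : H →L[ℂ] H) (T TΘ : QMS H)
    (r : ℝ) : Prop :=
  (∀ t, choiEntropy e ρ T TΘ t ≠ ⊤ ∧ choiEntropy e ρ T TΘ t ≠ ⊥) ∧
    HasDerivWithinAt (fun t : ℝ => (choiEntropy e ρ T TΘ t.toNNReal).toReal) r (Set.Ici 0) 0

end Rate

end QuantumMarkov

end

open QuantumMarkov

/-!
Detailed balance `T'_t = Θ ∘ T_t ∘ Θ` means that the semigroup coincides with its `Θ`-KMS adjoint,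
`T_t = TΘ_t` for all `t` (`thetaSQDB_iff_map_eq`). One direction compares the two adjoint
relations on rank one operators `y`, using that `ρ^½` has dense range. For the other, `Θ ∘ T_t ∘
Θ` has to be a quantum Markov semigroup. It is completely positive since `Θ` is, on Hermitian
matrices, transposition followed by an entrywise antilinear `*`-automorphism, and it is normal
since `Θ` preserves trace class operators and the trace. The latter rests on writing a trace class
operator as a product of two Hilbert-Schmidt operators, for which basis independence and cyclicity
of the trace are an exchange of two sums.

It remains to see that the relative entropy of the Choi-Jamiolkowski operators `J`, `JΘ` vanishes
exactly when `T_t = TΘ_t` (`choiEntropy_eq_zero_iff`). In the Heisenberg picture the matrix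
entries of `J` are `⟨ρ^½ e_k', T_t(|e_l'⟩⟨e_l|) ρ^½ e_k⟩`. By complete positivity they form the
Gram kernel of a family of vectors `Z`, and `∑ ‖Z_i‖² ≤ tr ρ = 1` because `T_t` is unital; so `J =
W* W` with `W` Hilbert-Schmidt, and `J` is a positive trace class operator of trace at most one
(`choiJamiolkowski_spec`). For `T` itself the trace equals one by invariance of `ρ`
(`tsum_choiKernel_eq`). Diagonalizing both operators, `a log a - a log b ≥ a - b`, with equality
only for `a = b`, gives `S(J, JΘ) ≥ tr J - tr JΘ ≥ 0`, and `S(J, JΘ) = 0` forces every eigenvector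
of `J` to be one of `JΘ` with the same eigenvalue, so that `J = JΘ` (`eq_of_relEntropy_eq_zero`).
Finally `J` determines `T_t` (`eq_of_choiJamiolkowski`). Under detailed balance the relative
entropy is thus identically zero, and so is its derivative.
-/

noncomputable section

namespace QuantumMarkov

universe u v

/-! ### Hilbert-Schmidt operators -/

section HilbertSchmidt

theorem summable_norm_sq_iff {E : Type*} [NormedAddCommGroup E] {ι : Type*} (f : ι → E) :
    Summable (fun i => ‖f i‖ ^ 2) ↔ ∑' i, ‖f i‖ₑ ^ 2 ≠ ∞ := by
  have : ∀ i, ‖f i‖ₑ ^ 2 = ((‖f i‖₊ ^ 2 : ℝ≥0) : ℝ≥0∞) := fun i => by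
    simp [enorm_eq_nnnorm]
  simp_rw [this, ENNReal.tsum_coe_ne_top_iff_summable, ← NNReal.summable_coe]
  simp

variable {H : Type*} [NormedAddCommGroup H] [InnerProductSpace ℂ H]

theorem hasSum_norm_inner_sq {κ : Type*} (c : HilbertBasis κ ℂ H) (x : H) :
    HasSum (fun j => ‖⟪c j, x⟫_ℂ‖ ^ 2) (‖x‖ ^ 2) := by
  have h := Complex.hasSum_re (c.hasSum_inner_mul_inner x x)
  rw [inner_self_eq_norm_sq_to_K] at h
  convert h using 1
  · ext j
    rw [← inner_conj_symm x (c j), ← Complex.normSq_eq_conj_mul_self, Complex.normSq_eq_norm_sq]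
    norm_cast
  · norm_cast

theorem tsum_enorm_inner_sq {κ : Type*} (c : HilbertBasis κ ℂ H) (x : H) :
    ∑' j, ‖⟪c j, x⟫_ℂ‖ₑ ^ 2 = ‖x‖ₑ ^ 2 := by
  have h := hasSum_norm_inner_sq c x
  have h4 := congrArg ENNReal.ofReal h.tsum_eq
  rw [ENNReal.ofReal_tsum_of_nonneg (fun _ => by positivity) h.summable] at h4
  simpa [ENNReal.ofReal_pow] using h4

theorem summable_inner_of_summable_norm_sq {ι : Type*} {f g : ι → H}
    (hf : Summable fun i => ‖f i‖ ^ 2) (hg : Summable fun i => ‖g i‖ ^ 2) :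
    Summable fun i => ⟪f i, g i⟫_ℂ := by
  refine Summable.of_norm_bounded (hf.add hg) fun i => ?_
  have := norm_inner_le_norm (𝕜 := ℂ) (f i) (g i)
  nlinarith [sq_nonneg (‖f i‖ - ‖g i‖), sq_nonneg (‖f i‖), sq_nonneg (‖g i‖)]

variable [CompleteSpace H]
variable {K : Type*} [NormedAddCommGroup K] [InnerProductSpace ℂ K] [CompleteSpace K]

/-- The Hilbert-Schmidt norm of `A`, computed in a basis of the domain, agrees with that of `A*`,
computed in a basis of the codomain; so neither depends on the basis. -/
theorem tsum_enorm_sq_adjoint {ι κ : Type*} (b : HilbertBasis ι ℂ H) (c : HilbertBasis κ ℂ K)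
    (A : H →L[ℂ] K) :
    ∑' i, ‖A (b i)‖ₑ ^ 2 = ∑' j, ‖ContinuousLinearMap.adjoint A (c j)‖ₑ ^ 2 := by
  simp_rw [← tsum_enorm_inner_sq c, ← tsum_enorm_inner_sq b]
  rw [ENNReal.tsum_comm]
  refine tsum_congr fun j => tsum_congr fun i => ?_
  rw [ContinuousLinearMap.adjoint_inner_right, ← ofReal_norm, ← ofReal_norm, norm_inner_symm]

/-- `A` is a Hilbert-Schmidt operator: `∑ᵢ ‖A bᵢ‖² < ∞` in some, equivalently every, Hilbert
basis. -/
def IsHilbertSchmidt (A : H →L[ℂ] H) : Prop :=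
  Summable fun i => ‖A (stdBasis H i)‖ ^ 2

theorem isHilbertSchmidt_iff {ι : Type*} (b : HilbertBasis ι ℂ H) (A : H →L[ℂ] H) :
    IsHilbertSchmidt A ↔ Summable fun i => ‖A (b i)‖ ^ 2 := by
  rw [IsHilbertSchmidt, summable_norm_sq_iff, summable_norm_sq_iff,
    tsum_enorm_sq_adjoint (stdBasis H) (stdBasis H), tsum_enorm_sq_adjoint b (stdBasis H)]

theorem IsHilbertSchmidt.summable {A : H →L[ℂ] H} (hA : IsHilbertSchmidt A) {ι : Type*}
    (b : HilbertBasis ι ℂ H) : Summable fun i => ‖A (b i)‖ ^ 2 :=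
  (isHilbertSchmidt_iff b A).1 hA

theorem IsHilbertSchmidt.adjoint {A : H →L[ℂ] H} (hA : IsHilbertSchmidt A) :
    IsHilbertSchmidt (ContinuousLinearMap.adjoint A) := by
  rw [IsHilbertSchmidt, summable_norm_sq_iff] at hA ⊢
  rwa [← tsum_enorm_sq_adjoint (stdBasis H) (stdBasis H)]

theorem IsHilbertSchmidt.mul_left {A : H →L[ℂ] H} (hA : IsHilbertSchmidt A) (X : H →L[ℂ] H) :
    IsHilbertSchmidt (X * A) := by
  refine Summable.of_nonneg_of_le (fun _ => by positivity) (fun i => ?_)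
    (Summable.mul_left (‖X‖ ^ 2) hA)
  rw [← mul_pow]
  gcongr
  exact X.le_opNorm _

theorem IsHilbertSchmidt.mul_right {A : H →L[ℂ] H} (hA : IsHilbertSchmidt A) (X : H →L[ℂ] H) :
    IsHilbertSchmidt (A * X) := by
  have h := (hA.adjoint.mul_left (ContinuousLinearMap.adjoint X)).adjoint
  simp only [← ContinuousLinearMap.star_eq_adjoint] at h
  simpa using h

/-- The double series `∑ᵢⱼ |⟨c_j, A b_i⟩|²` converges for Hilbert-Schmidt `A`. -/
theorem IsHilbertSchmidt.summable_prod {A : H →L[ℂ] H} (hA : IsHilbertSchmidt A) {ι κ : Type*}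
    (b : HilbertBasis ι ℂ H) (c : HilbertBasis κ ℂ H) :
    Summable fun p : ι × κ => ‖⟪c p.2, A (b p.1)⟫_ℂ‖ ^ 2 := by
  rw [summable_norm_sq_iff (E := ℂ), ENNReal.tsum_prod (f := fun i j => ‖⟪c j, A (b i)⟫_ℂ‖ₑ ^ 2)]
  simp_rw [tsum_enorm_inner_sq c]
  rw [← summable_norm_sq_iff]
  exact hA.summable b

/-- The Hilbert-Schmidt form of the cyclicity of the trace: `tr(A* B) = tr(B A*)`, with the two
sides computed in arbitrary bases. -/
theorem tsum_inner_hilbertSchmidt {A B : H →L[ℂ] H} (hA : IsHilbertSchmidt A)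
    (hB : IsHilbertSchmidt B) {ι κ : Type*} (b : HilbertBasis ι ℂ H) (c : HilbertBasis κ ℂ H) :
    ∑' i, ⟪A (b i), B (b i)⟫_ℂ =
      ∑' j, ⟪ContinuousLinearMap.adjoint B (c j), ContinuousLinearMap.adjoint A (c j)⟫_ℂ := by
  have hs : Summable fun p : ι × κ => ⟪A (b p.1), c p.2⟫_ℂ * ⟪c p.2, B (b p.1)⟫_ℂ := by
    refine Summable.of_norm_bounded ((hA.summable_prod b c).add (hB.summable_prod b c))
      fun p => ?_
    rw [norm_mul, norm_inner_symm]
    nlinarith [sq_nonneg (‖⟪c p.2, A (b p.1)⟫_ℂ‖ - ‖⟪c p.2, B (b p.1)⟫_ℂ‖),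
      sq_nonneg (‖⟪c p.2, A (b p.1)⟫_ℂ‖), sq_nonneg (‖⟪c p.2, B (b p.1)⟫_ℂ‖)]
  calc ∑' i, ⟪A (b i), B (b i)⟫_ℂ
      = ∑' i, ∑' j, ⟪A (b i), c j⟫_ℂ * ⟪c j, B (b i)⟫_ℂ := by
        simp_rw [c.tsum_inner_mul_inner]
    _ = ∑' j, ∑' i, ⟪A (b i), c j⟫_ℂ * ⟪c j, B (b i)⟫_ℂ := hs.tsum_comm.symm
    _ = _ := by
        refine tsum_congr fun j => ?_
        rw [← b.tsum_inner_mul_inner]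
        refine tsum_congr fun i => ?_
        rw [ContinuousLinearMap.adjoint_inner_left, ContinuousLinearMap.adjoint_inner_right,
          mul_comm]

end HilbertSchmidt

/-! ### Trace class operators -/

section TraceClassOperators

variable {H : Type u} [NormedAddCommGroup H] [InnerProductSpace ℂ H] [CompleteSpace H]

/-- Douglas factorization: if `‖A x‖ ≤ ‖B x‖` for all `x`, then `A` factors through `B`. -/
theorem exists_eq_mul_of_norm_le {A B : H →L[ℂ] H} (h : ∀ x, ‖A x‖ ≤ ‖B x‖) :
    ∃ U : H →L[ℂ] H, A = U * B := by
  let R : Submodule ℂ H := (LinearMap.range (B : H →ₗ[ℂ] H)).topologicalClosure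
  have hmem : ∀ x, B x ∈ R := fun x =>
    Submodule.le_topologicalClosure _ (LinearMap.mem_range_self (B : H →ₗ[ℂ] H) x)
  let B' : H →ₗ[ℂ] R := (B : H →ₗ[ℂ] H).codRestrict R hmem
  have : CompleteSpace R := (Submodule.isClosed_topologicalClosure _).completeSpace_coe
  have hd : DenseRange B' := by
    intro y
    rw [Metric.mem_closure_iff]
    intro ε hε
    obtain ⟨z, ⟨x, rfl⟩, hz⟩ := Metric.mem_closure_iff.1 y.2 ε hε
    exact ⟨B' x, ⟨x, rfl⟩, hz⟩
  refine ⟨((A : H →ₗ[ℂ] H).extendOfNorm B').comp R.orthogonalProjectionOnto, ?_⟩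
  ext x
  have h1 : R.orthogonalProjectionOnto (B x) = B' x :=
    Submodule.orthogonalProjectionOnto_mem_subspace_eq_self (K := R) ⟨B x, hmem x⟩
  simp only [mul_apply_eq_comp, ContinuousLinearMap.comp_apply]
  rw [h1, LinearMap.extendOfNorm_eq hd ⟨1, fun x => by simpa [B'] using h x⟩]
  rfl

theorem norm_abs_apply (A : H →L[ℂ] H) (x : H) : ‖CFC.abs A x‖ = ‖A x‖ := by
  have h1 : IsSelfAdjoint (CFC.abs A) := (CFC.abs_nonneg A).isSelfAdjoint
  have h : ⟪CFC.abs A x, CFC.abs A x⟫_ℂ = ⟪A x, A x⟫_ℂ := by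
    rw [← ContinuousLinearMap.adjoint_inner_right, ← ContinuousLinearMap.adjoint_inner_right,
      ← ContinuousLinearMap.star_eq_adjoint, ← ContinuousLinearMap.star_eq_adjoint, h1.star_eq,
      ← mul_apply_eq_comp, ← mul_apply_eq_comp, CFC.abs_mul_abs]
  rw [inner_self_eq_norm_sq_to_K, inner_self_eq_norm_sq_to_K] at h
  have h2 : ‖CFC.abs A x‖ ^ 2 = ‖A x‖ ^ 2 := by exact_mod_cast h
  exact (sq_eq_sq₀ (norm_nonneg _) (norm_nonneg _)).1 h2

theorem exists_eq_mul_abs (A : H →L[ℂ] H) : ∃ U : H →L[ℂ] H, A = U * CFC.abs A :=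
  exists_eq_mul_of_norm_le fun x => (norm_abs_apply A x).ge

theorem exists_abs_eq_mul (A : H →L[ℂ] H) : ∃ U : H →L[ℂ] H, CFC.abs A = U * A :=
  exists_eq_mul_of_norm_le fun x => (norm_abs_apply A x).le

theorem inner_sqrt_right (A : H →L[ℂ] H) (x y : H) :
    ⟪x, CFC.sqrt A y⟫_ℂ = ⟪CFC.sqrt A x, y⟫_ℂ := by
  have h1 : IsSelfAdjoint (CFC.sqrt A) := (CFC.sqrt_nonneg A).isSelfAdjoint
  rw [← ContinuousLinearMap.adjoint_inner_left, ← ContinuousLinearMap.star_eq_adjoint, h1.star_eq]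

theorem inner_sqrt_sqrt {A : H →L[ℂ] H} (hA : 0 ≤ A) (x y : H) :
    ⟪CFC.sqrt A x, CFC.sqrt A y⟫_ℂ = ⟪x, A y⟫_ℂ := by
  rw [← inner_sqrt_right, ← mul_apply_eq_comp, CFC.sqrt_mul_sqrt_self A hA]

theorem isHilbertSchmidt_sqrt_iff {A : H →L[ℂ] H} (hA : 0 ≤ A) {ι : Type*}
    (b : HilbertBasis ι ℂ H) :
    IsHilbertSchmidt (CFC.sqrt A) ↔ Summable fun i => ⟪b i, A (b i)⟫_ℂ := by
  rw [isHilbertSchmidt_iff b, ← Complex.summable_ofReal]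
  refine summable_congr fun i => ?_
  rw [← inner_sqrt_sqrt hA, inner_self_eq_norm_sq_to_K]
  norm_cast

theorem isTraceClass_mul_of_isHilbertSchmidt {B C : H →L[ℂ] H} (hB : IsHilbertSchmidt B)
    (hC : IsHilbertSchmidt C) : IsTraceClass (B * C) := by
  obtain ⟨U, hU⟩ := exists_abs_eq_mul (B * C)
  rw [IsTraceClass, hU]
  refine (summable_inner_of_summable_norm_sq ((hB.mul_left U).adjoint.summable (stdBasis H))
    (hC.summable (stdBasis H))).congr fun i => ?_
  rw [ContinuousLinearMap.adjoint_inner_left]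
  simp

/-- A trace class operator is a product of two Hilbert-Schmidt operators, `A = U |A|^½ |A|^½`. -/
theorem IsTraceClass.exists_eq_mul {A : H →L[ℂ] H} (hA : IsTraceClass A) :
    ∃ B C : H →L[ℂ] H, IsHilbertSchmidt B ∧ IsHilbertSchmidt C ∧ A = B * C := by
  obtain ⟨U, hU⟩ := exists_eq_mul_abs A
  have h := (isHilbertSchmidt_sqrt_iff (CFC.abs_nonneg A) (stdBasis H)).2 hA
  refine ⟨U * CFC.sqrt (CFC.abs A), CFC.sqrt (CFC.abs A), h.mul_left U, h, ?_⟩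
  rw [mul_assoc, CFC.sqrt_mul_sqrt_self _ (CFC.abs_nonneg A)]
  exact hU

theorem trace_mul_eq_tsum {B C : H →L[ℂ] H} (hB : IsHilbertSchmidt B)
    (hC : IsHilbertSchmidt C) {κ : Type*} (c : HilbertBasis κ ℂ H) :
    trace (B * C) = ∑' j, ⟪c j, C (B (c j))⟫_ℂ := by
  have h := tsum_inner_hilbertSchmidt hB.adjoint hC (stdBasis H) c
  simp only [ContinuousLinearMap.adjoint_adjoint, ContinuousLinearMap.adjoint_inner_left] at h
  exact h

theorem trace_mul_comm_of_isHilbertSchmidt {B C : H →L[ℂ] H} (hB : IsHilbertSchmidt B)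
    (hC : IsHilbertSchmidt C) : trace (B * C) = trace (C * B) :=
  trace_mul_eq_tsum hB hC (stdBasis H)

/-- The trace of a trace class operator may be computed in any Hilbert basis. -/
theorem IsTraceClass.trace_eq_tsum {A : H →L[ℂ] H} (hA : IsTraceClass A) {κ : Type*}
    (c : HilbertBasis κ ℂ H) : trace A = ∑' j, ⟪c j, A (c j)⟫_ℂ := by
  obtain ⟨B, C, hB, hC, rfl⟩ := hA.exists_eq_mul
  rw [trace_mul_comm_of_isHilbertSchmidt hB hC, trace_mul_eq_tsum hC hB c]
  rfl

theorem trace_mul_comm {A : H →L[ℂ] H} (hA : IsTraceClass A) (X : H →L[ℂ] H) :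
    trace (A * X) = trace (X * A) := by
  obtain ⟨B, C, hB, hC, rfl⟩ := hA.exists_eq_mul
  rw [mul_assoc, trace_mul_comm_of_isHilbertSchmidt hB (hC.mul_right X), mul_assoc,
    trace_mul_comm_of_isHilbertSchmidt hC (hB.mul_left X), mul_assoc]

theorem IsTraceClass.mul_right {A : H →L[ℂ] H} (hA : IsTraceClass A) (X : H →L[ℂ] H) :
    IsTraceClass (A * X) := by
  obtain ⟨B, C, hB, hC, rfl⟩ := hA.exists_eq_mul
  rw [mul_assoc]
  exact isTraceClass_mul_of_isHilbertSchmidt hB (hC.mul_right X)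

theorem IsTraceClass.mul_left {A : H →L[ℂ] H} (hA : IsTraceClass A) (X : H →L[ℂ] H) :
    IsTraceClass (X * A) := by
  obtain ⟨B, C, hB, hC, rfl⟩ := hA.exists_eq_mul
  rw [← mul_assoc]
  exact isTraceClass_mul_of_isHilbertSchmidt (hB.mul_left X) hC

theorem trace_mul_rankOne (A : H →L[ℂ] H) (u v : H) :
    trace (A * rankOne ℂ u v) = ⟪v, A u⟫_ℂ := by
  rw [← (stdBasis H).tsum_inner_mul_inner]
  refine tsum_congr fun i => ?_
  simp [InnerProductSpace.rankOne_apply]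

theorem trace_rankOne_mul (A : H →L[ℂ] H) (u v : H) :
    trace (rankOne ℂ u v * A) = ⟪v, A u⟫_ℂ := by
  rw [← ContinuousLinearMap.adjoint_inner_left, ← (stdBasis H).tsum_inner_mul_inner]
  refine tsum_congr fun i => ?_
  simp [InnerProductSpace.rankOne_apply, ContinuousLinearMap.adjoint_inner_left]

end TraceClassOperators

/-! ### The reversing operation -/

section Reversing

variable {H : Type u} [NormedAddCommGroup H] [InnerProductSpace ℂ H]

/-- An anti-unitary operator reverses inner products, by polarization. -/
theorem inner_antiunitary (θ : H ≃ₗᵢ⋆[ℂ] H) (u v : H) : ⟪θ u, θ v⟫_ℂ = ⟪v, u⟫_ℂ := by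
  have h : ∀ z : H, Complex.I • θ z = - θ (Complex.I • z) := fun z => by
    rw [map_smulₛₗ θ, Complex.conj_I, neg_smul, neg_neg]
  rw [← inner_conj_symm v u, inner_eq_sum_norm_sq_div_four (θ u) (θ v),
    inner_eq_sum_norm_sq_div_four u v]
  simp only [RCLike.I_to_complex]
  rw [h, sub_neg_eq_add, ← sub_eq_add_neg, ← map_add, ← map_sub, ← map_add, ← map_sub]
  simp only [LinearIsometryEquiv.norm_map]
  simp only [map_div₀, map_add, map_sub, map_mul, map_pow, RCLike.conj_ofReal, Complex.conj_I,
    map_ofNat]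
  ring

variable [CompleteSpace H]

/-- The image of a Hilbert basis under an anti-unitary involution. -/
def antiunitaryBasis (θ : H ≃ₗᵢ⋆[ℂ] H) (hθ : ∀ u, θ (θ u) = u) {ι : Type*}
    (b : HilbertBasis ι ℂ H) : HilbertBasis ι ℂ H :=
  HilbertBasis.mkOfOrthogonalEqBot (v := fun i => θ (b i))
    (by
      classical
      rw [orthonormal_iff_ite]
      intro i j
      rw [inner_antiunitary, orthonormal_iff_ite.1 b.orthonormal]
      simp only [eq_comm])
    (by
      rw [Submodule.eq_bot_iff]
      intro x hx
      rw [Submodule.mem_orthogonal] at hx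
      have h0 : θ x = 0 := by
        have h := tsum_enorm_inner_sq b (θ x)
        have h' : ∀ i, ⟪b i, θ x⟫_ℂ = 0 := fun i => by
          rw [← hθ (b i), inner_antiunitary, ← inner_conj_symm,
            hx _ (Submodule.subset_span ⟨i, rfl⟩), map_zero]
        simpa [h'] using h.symm
      simpa using h0)

theorem antiunitaryBasis_apply (θ : H ≃ₗᵢ⋆[ℂ] H) (hθ : ∀ u, θ (θ u) = u) {ι : Type*}
    (b : HilbertBasis ι ℂ H) (i : ι) : antiunitaryBasis θ hθ b i = θ (b i) := by
  simp [antiunitaryBasis]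

theorem reversing_apply (θ : H ≃ₗᵢ⋆[ℂ] H) (x : H →L[ℂ] H) (u : H) :
    reversing θ x u = θ (ContinuousLinearMap.adjoint x (θ u)) := rfl

variable {θ : H ≃ₗᵢ⋆[ℂ] H}

theorem reversing_star (hθ : ∀ u, θ (θ u) = u) (x : H →L[ℂ] H) :
    reversing θ (star x) = star (reversing θ x) := by
  rw [ContinuousLinearMap.star_eq_adjoint, ContinuousLinearMap.star_eq_adjoint,
    ContinuousLinearMap.eq_adjoint_iff]
  intro u v
  rw [reversing_apply, reversing_apply, ContinuousLinearMap.adjoint_adjoint]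
  conv_lhs => rw [← hθ v]
  conv_rhs => rw [← hθ u]
  rw [inner_antiunitary, inner_antiunitary, ContinuousLinearMap.adjoint_inner_left]

theorem reversing_reversing (hθ : ∀ u, θ (θ u) = u) (x : H →L[ℂ] H) :
    reversing θ (reversing θ x) = x := by
  ext u
  rw [reversing_apply, ← ContinuousLinearMap.star_eq_adjoint, ← reversing_star hθ, reversing_apply,
    ContinuousLinearMap.star_eq_adjoint, ContinuousLinearMap.adjoint_adjoint, hθ, hθ]

theorem reversing_mul (hθ : ∀ u, θ (θ u) = u) (x y : H →L[ℂ] H) :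
    reversing θ (x * y) = reversing θ y * reversing θ x := by
  ext u
  rw [mul_apply_eq_comp, reversing_apply, reversing_apply, reversing_apply, hθ,
    ← ContinuousLinearMap.star_eq_adjoint, star_mul]
  rfl

variable (θ) in
/-- The reversing operation `Θ` as a bounded linear map: it is linear since both `x ↦ x*` and
conjugation by `θ` are antilinear. -/
def reversingL : (H →L[ℂ] H) →L[ℂ] (H →L[ℂ] H) :=
  LinearMap.mkContinuous
    { toFun := reversing θ
      map_add' := fun x y => by ext u; simp [reversing_apply]
      map_smul' := fun c x => by
        ext u
        rw [reversing_apply, ← ContinuousLinearMap.star_eq_adjoint, star_smul]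
        simp [reversing_apply, map_smulₛₗ θ, ContinuousLinearMap.star_eq_adjoint] } 1
    (fun x => by
      rw [one_mul]
      refine ContinuousLinearMap.opNorm_le_bound _ (norm_nonneg _) fun u => ?_
      change ‖reversing θ x u‖ ≤ _
      rw [reversing_apply, LinearIsometryEquiv.norm_map]
      refine ((ContinuousLinearMap.adjoint x).le_opNorm _).trans ?_
      rw [LinearIsometryEquiv.norm_map, LinearIsometryEquiv.norm_map])

@[simp]
theorem reversingL_apply (x : H →L[ℂ] H) : reversingL θ x = reversing θ x := rfl

theorem IsHilbertSchmidt.reversing (hθ : ∀ u, θ (θ u) = u) {A : H →L[ℂ] H}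
    (hA : IsHilbertSchmidt A) : IsHilbertSchmidt (reversing θ A) := by
  refine (hA.adjoint.summable (antiunitaryBasis θ hθ (stdBasis H))).congr fun i => ?_
  rw [antiunitaryBasis_apply, reversing_apply, LinearIsometryEquiv.norm_map]

theorem IsTraceClass.reversing (hθ : ∀ u, θ (θ u) = u) {A : H →L[ℂ] H}
    (hA : IsTraceClass A) : IsTraceClass (reversing θ A) := by
  obtain ⟨B, C, hB, hC, rfl⟩ := hA.exists_eq_mul
  rw [reversing_mul hθ]
  exact isTraceClass_mul_of_isHilbertSchmidt (hC.reversing hθ) (hB.reversing hθ)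

theorem trace_reversing (hθ : ∀ u, θ (θ u) = u) {A : H →L[ℂ] H}
    (hA : IsTraceClass A) : trace (reversing θ A) = trace A := by
  rw [hA.trace_eq_tsum (antiunitaryBasis θ hθ (stdBasis H)), trace]
  refine tsum_congr fun i => ?_
  rw [antiunitaryBasis_apply, reversing_apply]
  conv_lhs => rw [← hθ (stdBasis H i)]
  rw [inner_antiunitary, hθ, ContinuousLinearMap.adjoint_inner_left]

/-! ### The conjugated semigroup -/

/-- The existence of square roots in a C*-algebra, in a form that applies to `CStarMatrix`. -/
theorem exists_eq_star_mul_self_of_nonneg {A : Type*} [NonUnitalCStarAlgebra A] [PartialOrder A]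
    [StarOrderedRing A] {M : A} (hM : 0 ≤ M) : ∃ N, M = star N * N :=
  CStarAlgebra.nonneg_iff_eq_star_mul_self.1 hM

/-- Applying the antilinear `*`-automorphism `x ↦ Θ(x*)` to the entries of a matrix over `B(H)`
preserves positivity. -/
theorem map_reversing_star_nonneg (hθ : ∀ u, θ (θ u) = u) {k : ℕ}
    {M : CStarMatrix (Fin k) (Fin k) (H →L[ℂ] H)} (hM : 0 ≤ M) :
    0 ≤ M.map fun x => reversing θ (star x) := by
  obtain ⟨N, rfl⟩ := exists_eq_star_mul_self_of_nonneg hM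
  have : (star N * N).map (fun x => reversing θ (star x)) =
      star (N.map fun x => reversing θ (star x)) * N.map (fun x => reversing θ (star x)) := by
    ext1 i j
    simp only [CStarMatrix.map_apply, CStarMatrix.mul_apply, CStarMatrix.star_apply, star_sum,
      star_mul, star_star]
    rw [← reversingL_apply, map_sum]
    refine Finset.sum_congr rfl fun l _ => ?_
    rw [reversingL_apply, reversing_mul hθ, reversing_star hθ (N l i), star_star]
  rw [this]
  exact star_mul_self_nonneg _

/-- Conjugation by `Θ` preserves complete positivity. Though `Θ` itself is an anti-homomorphism, on
Hermitian matrices it acts as transposition composed with the entrywise `*`-automorphism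
`x ↦ Θ(x*)`, and the two transpositions cancel. -/
theorem IsCompletelyPositive.reversing_conj (hθ : ∀ u, θ (θ u) = u)
    {Φ : (H →L[ℂ] H) →L[ℂ] (H →L[ℂ] H)} (hΦ : IsCompletelyPositive Φ) :
    IsCompletelyPositive ((reversingL θ).comp (Φ.comp (reversingL θ))) := by
  obtain ⟨Ψ, hΨ⟩ := hΦ
  refine ⟨⟨((reversingL θ).comp (Φ.comp (reversingL θ)) :
    (H →L[ℂ] H) →ₗ[ℂ] (H →L[ℂ] H)), fun k M hM => ?_⟩, fun x => rfl⟩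
  have hN := CompletelyPositiveMap.map_cstarMatrix_nonneg Ψ _ (map_reversing_star_nonneg hθ hM)
  have h := map_reversing_star_nonneg hθ hN
  convert h using 1
  ext1 i j
  have h1 : star (M j i) = M i j := congrFun (congrFun hM.isSelfAdjoint.star_eq i) j
  have h2 := congrFun (congrFun hN.isSelfAdjoint.star_eq j) i
  simp only [CStarMatrix.star_apply, CStarMatrix.map_apply] at h2
  simp only [CStarMatrix.map_apply]
  rw [h2, h1, hΨ]
  rfl

theorem IsNormal.reversing_conj (hθ : ∀ u, θ (θ u) = u)
    {Φ : (H →L[ℂ] H) →L[ℂ] (H →L[ℂ] H)} (hΦ : IsNormal Φ) :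
    IsNormal ((reversingL θ).comp (Φ.comp (reversingL θ))) := by
  obtain ⟨Φs, hΦs⟩ := hΦ
  refine ⟨fun σ => ⟨reversing θ (Φs ⟨reversing θ σ.1, σ.2.reversing hθ⟩).1,
    (Φs _).2.reversing hθ⟩, fun σ x => ?_⟩
  have h := hΦs ⟨reversing θ σ.1, σ.2.reversing hθ⟩ (reversing θ x)
  set τ := Φs ⟨reversing θ σ.1, σ.2.reversing hθ⟩
  have hσ := σ.2.reversing hθ
  calc trace (reversing θ τ.1 * x)
      = trace (reversing θ (reversing θ x * τ.1)) := by
        rw [reversing_mul hθ, reversing_reversing hθ]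
    _ = trace (τ.1 * reversing θ x) := by
        rw [trace_reversing hθ (τ.2.mul_left _), trace_mul_comm τ.2]
    _ = trace (reversing θ (reversing θ σ.1 * Φ (reversing θ x))) := by
        rw [h, trace_reversing hθ (hσ.mul_right _)]
    _ = _ := by
        rw [reversing_mul hθ, reversing_reversing hθ, ← trace_mul_comm σ.2]
        rfl

/-- The semigroup `Θ ∘ T_t ∘ Θ`. -/
def QMS.reversingConj (hθ : ∀ u, θ (θ u) = u) (T : QMS H) : QMS H where
  map t := (reversingL θ).comp ((T.map t).comp (reversingL θ))
  map_zero := by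
    ext1 x
    simp [T.map_zero, reversing_reversing hθ]
  map_add s t := by
    ext1 x
    simp [T.map_add, reversing_reversing hθ]
  completelyPositive t := (T.completelyPositive t).reversing_conj hθ
  normal t := (T.normal t).reversing_conj hθ
  unital t := by
    have h1 : reversing θ 1 = 1 := by
      ext u
      rw [reversing_apply, ← ContinuousLinearMap.star_eq_adjoint, star_one]
      exact hθ u
    simp [h1, T.unital]
  continuous := by
    have := T.continuous
    fun_prop

theorem QMS.reversingConj_map (hθ : ∀ u, θ (θ u) = u) (T : QMS H) (t : ℝ≥0) (x : H →L[ℂ] H) :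
    (T.reversingConj hθ).map t x = reversing θ (T.map t (reversing θ x)) := rfl

end Reversing

/-! ### Detailed balance as equality of semigroups -/

section DetailedBalance

variable {H : Type u} [NormedAddCommGroup H] [InnerProductSpace ℂ H]

theorem eq_of_inner_denseRange {A B S : H →L[ℂ] H} (hS : DenseRange S)
    (h : ∀ u v, ⟪S u, A (S v)⟫_ℂ = ⟪S u, B (S v)⟫_ℂ) : A = B := by
  have h1 : ∀ v, A (S v) = B (S v) := fun v => by
    have h2 : ∀ w, ⟪w, A (S v)⟫_ℂ = ⟪w, B (S v)⟫_ℂ := fun w =>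
      hS.induction_on (p := fun w => ⟪w, A (S v)⟫_ℂ = ⟪w, B (S v)⟫_ℂ) w
        (isClosed_eq (by fun_prop) (by fun_prop)) (fun u => h u v)
    exact ext_inner_left ℂ h2
  ext w
  exact hS.induction_on (p := fun w => A w = B w) w
    (isClosed_eq (by fun_prop) (by fun_prop)) h1

variable [CompleteSpace H]

/-- The KMS form `tr(ρ^½ x ρ^½ y)` determines `x`, since `ρ^½` has dense range. -/
theorem eq_of_trace_sqrt_eq {ρ : H →L[ℂ] H} (hrange : DenseRange (CFC.sqrt ρ : H →L[ℂ] H))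
    {A B : H →L[ℂ] H}
    (h : ∀ y, trace (CFC.sqrt ρ * A * CFC.sqrt ρ * y) =
      trace (CFC.sqrt ρ * B * CFC.sqrt ρ * y)) : A = B := by
  refine eq_of_inner_denseRange hrange fun u v => ?_
  have := h (rankOne ℂ v u)
  rw [trace_mul_rankOne, trace_mul_rankOne] at this
  simp only [mul_apply_eq_comp] at this
  rwa [inner_sqrt_right, inner_sqrt_right] at this

theorem IsThetaKMSAdjoint.trace_eq {θ : H ≃ₗᵢ⋆[ℂ] H} (hθ : ∀ u, θ (θ u) = u) {ρ : H →L[ℂ] H}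
    {T TΘ : QMS H} (hadj : IsThetaKMSAdjoint θ ρ T TΘ) (t : ℝ≥0) (z y : H →L[ℂ] H) :
    trace (CFC.sqrt ρ * z * CFC.sqrt ρ * T.map t y) =
      trace (CFC.sqrt ρ * reversing θ (TΘ.map t (reversing θ z)) * CFC.sqrt ρ * y) := by
  have h := hadj t (ContinuousLinearMap.adjoint (reversing θ z)) y
  rwa [ContinuousLinearMap.adjoint_adjoint, reversing_reversing hθ] at h

/-- `Θ`-standard quantum detailed balance says exactly that `T` is its own `Θ`-KMS adjoint. -/
theorem thetaSQDB_iff_map_eq {θ : H ≃ₗᵢ⋆[ℂ] H} (hθ : ∀ u, θ (θ u) = u) {ρ : H →L[ℂ] H}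
    (hrange : DenseRange (CFC.sqrt ρ : H →L[ℂ] H))
    {T TΘ : QMS H} (hadj : IsThetaKMSAdjoint θ ρ T TΘ) :
    ThetaSQDB θ ρ T ↔ ∀ t, T.map t = TΘ.map t := by
  constructor
  · rintro ⟨T', hT', h⟩ t
    ext1 x
    have h1 : T'.map t (reversing θ x) =
        reversing θ (TΘ.map t (reversing θ (reversing θ x))) :=
      eq_of_trace_sqrt_eq hrange fun y => by
        rw [← hT' t _ y, hadj.trace_eq hθ]
    rw [h, reversing_reversing hθ] at h1
    rw [← reversing_reversing hθ (T.map t x), h1, reversing_reversing hθ]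
  · intro h
    refine ⟨T.reversingConj hθ, fun t z y => ?_, fun t x => rfl⟩
    rw [hadj.trace_eq hθ, QMS.reversingConj_map, h]

end DetailedBalance

/-! ### Diagonalization of positive trace class operators -/

section Diagonalization

theorem hasSum_of_tsum_ofReal {α : Type*} {f : α → ℝ} {s : ℝ} (hf : ∀ i, 0 ≤ f i) (hs : 0 ≤ s)
    (h : ∑' i, ENNReal.ofReal (f i) = ENNReal.ofReal s) : HasSum f s := by
  have h1 := ENNReal.hasSum_toReal (f := fun i => ENNReal.ofReal (f i))
    (by rw [h]; exact ENNReal.ofReal_ne_top)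
  rw [← ENNReal.tsum_toReal_eq fun _ => ENNReal.ofReal_ne_top, h, ENNReal.toReal_ofReal hs] at h1
  simpa only [ENNReal.toReal_ofReal (hf _)] using h1

variable {K : Type u} [NormedAddCommGroup K] [InnerProductSpace ℂ K]

theorem isCompactOperator_rankOne (u v : K) : IsCompactOperator (rankOne ℂ u v) := by
  rw [InnerProductSpace.rankOne_def']
  exact (isCompactOperator_of_locallyCompactSpace_dom (M₂ := ℂ) (innerSL ℂ v)).clm_comp
    (.toSpanSingleton ℂ u)

theorem isSymmetric_of_nonneg {A : K →L[ℂ] K} (hA : 0 ≤ A) : (A : K →ₗ[ℂ] K).IsSymmetric :=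
  ((ContinuousLinearMap.nonneg_iff_isPositive A).1 hA).isSymmetric

theorem mem_eigen_iff {A : K →L[ℂ] K} {a : ℝ} {x : K} : x ∈ eigen A a ↔ A x = (a : ℂ) • x := by
  simp [eigen]

theorem re_inner_nonneg {A : K →L[ℂ] K} (hA : 0 ≤ A) (x : K) : 0 ≤ (⟪x, A x⟫_ℂ).re :=
  ((ContinuousLinearMap.nonneg_iff_isPositive A).1 hA).re_inner_nonneg_right x

theorem re_inner_eq {A : K →L[ℂ] K} {a : ℝ} {x : K} (hx : A x = (a : ℂ) • x) :
    (⟪x, A x⟫_ℂ).re = a * ‖x‖ ^ 2 := by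
  rw [hx, inner_smul_right, inner_self_eq_norm_sq_to_K]
  norm_cast
  rw [Complex.re_ofReal_mul]
  exact congrArg (a * ·) (RCLike.ofReal_re (K := ℂ) _)

theorem orthogonalFamily_eigen {A : K →L[ℂ] K} (hA : 0 ≤ A) :
    OrthogonalFamily ℂ (fun a : ℝ => eigen A a) fun a => (eigen A a).subtypeₗᵢ :=
  (isSymmetric_of_nonneg hA).orthogonalFamily_eigenspaces.comp Complex.ofReal_injective

variable [CompleteSpace K]

/-- The operator norm is bounded by the Hilbert-Schmidt norm. -/
theorem norm_sq_le_tsum {ι : Type*} (b : HilbertBasis ι ℂ K) {X : K →L[ℂ] K}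
    (hX : Summable fun i => ‖X (b i)‖ ^ 2) : ‖X‖ ^ 2 ≤ ∑' i, ‖X (b i)‖ ^ 2 := by
  have hS : 0 ≤ ∑' i, ‖X (b i)‖ ^ 2 := tsum_nonneg fun _ => by positivity
  have h1 : ‖ContinuousLinearMap.adjoint X‖ ≤ √(∑' i, ‖X (b i)‖ ^ 2) := by
    refine ContinuousLinearMap.opNorm_le_bound _ (Real.sqrt_nonneg _) fun y => ?_
    refine le_of_sq_le_sq ?_ (by positivity)
    rw [mul_pow, Real.sq_sqrt hS, ← tsum_mul_right]
    refine hasSum_le (fun i => ?_) (hasSum_norm_inner_sq b _) (hX.mul_right (‖y‖ ^ 2)).hasSum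
    rw [ContinuousLinearMap.adjoint_inner_right, ← mul_pow]
    gcongr
    exact norm_inner_le_norm _ _
  rw [LinearIsometryEquiv.norm_map] at h1
  calc ‖X‖ ^ 2 ≤ √(∑' i, ‖X (b i)‖ ^ 2) ^ 2 := by gcongr
    _ = _ := Real.sq_sqrt hS

theorem IsHilbertSchmidt.isCompactOperator {A : K →L[ℂ] K} (hA : IsHilbertSchmidt A) :
    IsCompactOperator A := by
  classical
  let b := stdBasis K
  let F : Finset (basisIndex K) → (K →L[ℂ] K) := fun s => ∑ i ∈ s, rankOne ℂ (A (b i)) (b i)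
  have hF : ∀ s, IsCompactOperator (F s) := fun s =>
    (compactOperator (RingHom.id ℂ) K K).sum_mem fun i _ => isCompactOperator_rankOne _ _
  have hval : ∀ s i, (A - F s) (b i) = if i ∈ s then 0 else A (b i) := fun s i => by
    have : F s (b i) = if i ∈ s then A (b i) else 0 := by
      simp [F, orthonormal_iff_ite.1 b.orthonormal, ite_smul]
    rw [sub_apply, this]
    split_ifs <;> simp
  have hn : ∀ s i, ‖(A - F s) (b i)‖ ^ 2 = Set.indicator {j | j ∉ s} (fun i => ‖A (b i)‖ ^ 2) i :=
    fun s i => by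
      rw [hval, Set.indicator_apply]
      by_cases h : i ∈ s <;> simp [h]
  have hlim : Filter.Tendsto (fun s => ‖A - F s‖ ^ 2) Filter.atTop (nhds 0) := by
    refine squeeze_zero (fun _ => by positivity) (fun s => ?_)
      (tendsto_tsum_compl_atTop_zero fun i => ‖A (b i)‖ ^ 2)
    refine (norm_sq_le_tsum b ?_).trans_eq ?_
    · simp_rw [hn]
      exact Summable.indicator (hA.summable b) _
    · simp_rw [hn]
      exact (tsum_subtype {j | j ∉ s} fun i => ‖A (b i)‖ ^ 2).symm
  refine isCompactOperator_of_tendsto (F := F) (l := Filter.atTop) ?_ (.of_forall hF)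
  rw [tendsto_iff_norm_sub_tendsto_zero]
  have h2 := hlim.sqrt
  simp only [Real.sqrt_sq (norm_nonneg _), Real.sqrt_zero] at h2
  simpa only [norm_sub_rev] using h2

theorem isTraceClass_iff_of_nonneg {A : K →L[ℂ] K} (hA : 0 ≤ A) :
    IsTraceClass A ↔ IsHilbertSchmidt (CFC.sqrt A) := by
  rw [IsTraceClass, CFC.abs_of_nonneg A hA, isHilbertSchmidt_sqrt_iff hA (stdBasis K)]

theorem IsTraceClass.isCompactOperator {A : K →L[ℂ] K} (hA : 0 ≤ A) (h : IsTraceClass A) :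
    IsCompactOperator A := by
  have h1 := ((isTraceClass_iff_of_nonneg hA).1 h).mul_left (CFC.sqrt A)
  rw [CFC.sqrt_mul_sqrt_self A hA] at h1
  exact h1.isCompactOperator

theorem orthonormal_eigen {A : K →L[ℂ] K} (hA : 0 ≤ A) :
    Orthonormal ℂ fun p : EigenIndex A => (stdBasis (eigen A p.1) p.2 : K) :=
  (orthogonalFamily_eigen hA).orthonormal_sigma_orthonormal
    fun a => (stdBasis (eigen A a)).orthonormal

/-- An orthonormal basis of eigenvectors of a positive trace class operator. -/
def eigenBasis {A : K →L[ℂ] K} (hA : 0 ≤ A) (h : IsTraceClass A) :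
    HilbertBasis (EigenIndex A) ℂ K :=
  HilbertBasis.mkOfOrthogonalEqBot (v := fun p => (stdBasis (eigen A p.1) p.2 : K))
    (orthonormal_eigen hA)
    (by
      rw [Submodule.eq_bot_iff]
      intro x hx
      rw [Submodule.mem_orthogonal] at hx
      have h1 : ∀ a : ℝ, x ∈ (eigen A a)ᗮ := fun a => by
        rw [← Submodule.orthogonalProjectionOnto_eq_zero_iff, ← enorm_eq_zero,
          ← pow_eq_zero_iff (two_ne_zero), ← tsum_enorm_inner_sq (stdBasis (eigen A a))]
        simp only [ENNReal.tsum_eq_zero]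
        intro i
        have := hx _ (Submodule.subset_span ⟨⟨a, i⟩, rfl⟩)
        rw [Submodule.inner_orthogonalProjectionOnto_eq_of_mem_left, this]
        simp
      have h2 : x ∈ (⨆ μ, Module.End.eigenspace (A : K →ₗ[ℂ] K) μ)ᗮ := by
        rw [← Submodule.iInf_orthogonal, Submodule.mem_iInf]
        intro μ
        by_cases hμ : Module.End.HasEigenvalue (A : K →ₗ[ℂ] K) μ
        · have h3 := (isSymmetric_of_nonneg hA).conj_eigenvalue_eq_self hμ
          obtain ⟨r, hr⟩ := Complex.conj_eq_iff_real.1 h3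
          rw [hr]
          exact h1 r
        · rw [Module.End.hasEigenvalue_iff, not_not] at hμ
          rw [hμ]
          simp
      rwa [ContinuousLinearMap.orthogonalComplement_iSup_eigenspaces_eq_bot
        (h.isCompactOperator hA) (isSymmetric_of_nonneg hA), Submodule.mem_bot] at h2)

theorem eigenBasis_apply {A : K →L[ℂ] K} (hA : 0 ≤ A) (h : IsTraceClass A) (p : EigenIndex A) :
    eigenBasis hA h p = (stdBasis (eigen A p.1) p.2 : K) := by
  exact congrFun (HilbertBasis.coe_mkOfOrthogonalEqBot _ _) p

theorem apply_eigenBasis {A : K →L[ℂ] K} (hA : 0 ≤ A) (h : IsTraceClass A) (p : EigenIndex A) :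
    A (eigenBasis hA h p) = (p.1 : ℂ) • eigenBasis hA h p := by
  rw [eigenBasis_apply]
  exact mem_eigen_iff.1 (stdBasis (eigen A p.1) p.2).2

theorem hasSum_re_trace {A : K →L[ℂ] K} (hA : 0 ≤ A) (h : IsTraceClass A) {ι : Type*}
    (b : HilbertBasis ι ℂ K) : HasSum (fun i => (⟪b i, A (b i)⟫_ℂ).re) (trace A).re := by
  rw [h.trace_eq_tsum b]
  have := (isHilbertSchmidt_sqrt_iff hA b).1 ((isTraceClass_iff_of_nonneg hA).1 h)
  exact Complex.hasSum_re this.hasSum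

theorem eigenIndex_nonneg {A : K →L[ℂ] K} (hA : 0 ≤ A) (h : IsTraceClass A) (p : EigenIndex A) :
    0 ≤ p.1 := by
  have := re_inner_nonneg hA (eigenBasis hA h p)
  rwa [re_inner_eq (apply_eigenBasis hA h p), (eigenBasis hA h).orthonormal.1 p, one_pow,
    mul_one] at this

theorem hasSum_eigenIndex {A : K →L[ℂ] K} (hA : 0 ≤ A) (h : IsTraceClass A) :
    HasSum (fun p : EigenIndex A => p.1) (trace A).re := by
  refine (hasSum_re_trace hA h (eigenBasis hA h)).congr_fun fun p => ?_
  rw [re_inner_eq (apply_eigenBasis hA h p), (eigenBasis hA h).orthonormal.1 p, one_pow,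
    mul_one]

theorem eigenIndex_le {A : K →L[ℂ] K} (hA : 0 ≤ A) (h : IsTraceClass A) (p : EigenIndex A) :
    p.1 ≤ (trace A).re :=
  le_hasSum (hasSum_eigenIndex hA h) p fun q _ => eigenIndex_nonneg hA h q

theorem norm_starProjection_sq_eq_tsum (A : K →L[ℂ] K) (b : ℝ) (x : K) :
    ENNReal.ofReal (‖(eigen A b).starProjection x‖ ^ 2) =
      ∑' j, ‖⟪(stdBasis (eigen A b) j : K), x⟫_ℂ‖ₑ ^ 2 := by
  rw [ENNReal.ofReal_pow (norm_nonneg _), ofReal_norm, Submodule.starProjection_apply]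
  change ‖(eigen A b).orthogonalProjectionOnto x‖ₑ ^ 2 = _
  rw [← tsum_enorm_inner_sq (stdBasis (eigen A b))]
  refine tsum_congr fun j => ?_
  rw [Submodule.inner_orthogonalProjectionOnto_eq_of_mem_left]

/-- Only the eigenvalues contribute to the spectral decomposition of a vector. -/
theorem nonneg_and_le_of_starProjection_ne_zero {A : K →L[ℂ] K} (hA : 0 ≤ A)
    (h : IsTraceClass A) {b : ℝ} {x : K} (hx : (eigen A b).starProjection x ≠ 0) :
    0 ≤ b ∧ b ≤ (trace A).re := by
  have : Nonempty (basisIndex (eigen A b)) := by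
    by_contra hne
    rw [not_nonempty_iff] at hne
    have h0 := norm_starProjection_sq_eq_tsum A b x
    rw [tsum_empty, ENNReal.ofReal_eq_zero] at h0
    have := norm_pos_iff.2 hx
    nlinarith
  obtain ⟨j⟩ := this
  exact ⟨eigenIndex_nonneg hA h ⟨b, j⟩, eigenIndex_le hA h ⟨b, j⟩⟩

/-- The weights `‖P_b x‖²` of the spectral decomposition of `x` add up to `‖x‖²`. -/
theorem hasSum_norm_starProjection_sq {A : K →L[ℂ] K} (hA : 0 ≤ A) (h : IsTraceClass A) (x : K) :
    HasSum (fun b : ℝ => ‖(eigen A b).starProjection x‖ ^ 2) (‖x‖ ^ 2) := by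
  have h1 : ∑' b : ℝ, ENNReal.ofReal (‖(eigen A b).starProjection x‖ ^ 2) =
      ENNReal.ofReal (‖x‖ ^ 2) := by
    rw [ENNReal.ofReal_pow (norm_nonneg _), ofReal_norm, ← tsum_enorm_inner_sq (eigenBasis hA h),
      ENNReal.tsum_sigma']
    refine tsum_congr fun b => ?_
    rw [norm_starProjection_sq_eq_tsum]
    simp_rw [eigenBasis_apply]
  exact hasSum_of_tsum_ofReal (fun _ => by positivity) (by positivity) h1

/-- The spectral decomposition of the quadratic form of `A`. -/
theorem hasSum_norm_starProjection_sq_mul {A : K →L[ℂ] K} (hA : 0 ≤ A) (h : IsTraceClass A)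
    (x : K) :
    HasSum (fun b : ℝ => ‖(eigen A b).starProjection x‖ ^ 2 * b) (⟪x, A x⟫_ℂ).re := by
  let u := eigenBasis hA h
  have h1 : HasSum (fun p : EigenIndex A => p.1 * ‖⟪u p, x⟫_ℂ‖ ^ 2) (⟪x, A x⟫_ℂ).re := by
    refine (Complex.hasSum_re (u.hasSum_inner_mul_inner x (A x))).congr_fun fun p => ?_
    rw [← ContinuousLinearMap.coe_coe A, ← isSymmetric_of_nonneg hA, ContinuousLinearMap.coe_coe,
      apply_eigenBasis, inner_smul_left, Complex.conj_ofReal, mul_left_comm,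
      ← inner_conj_symm x, ← Complex.normSq_eq_conj_mul_self, Complex.normSq_eq_norm_sq,
      ← Complex.ofReal_mul, Complex.ofReal_re]
  have h0 : ∀ b : ℝ, 0 ≤ ‖(eigen A b).starProjection x‖ ^ 2 * b := fun b => by
    by_cases hb : (eigen A b).starProjection x = 0
    · simp [hb]
    · exact mul_nonneg (by positivity) (nonneg_and_le_of_starProjection_ne_zero hA h hb).1
  refine hasSum_of_tsum_ofReal h0 (re_inner_nonneg hA x) ?_
  rw [← h1.tsum_eq, ENNReal.ofReal_tsum_of_nonneg
    (fun p => mul_nonneg (eigenIndex_nonneg hA h p) (by positivity)) h1.summable,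
    ENNReal.tsum_sigma']
  refine tsum_congr fun b => ?_
  rw [ENNReal.ofReal_mul (by positivity), norm_starProjection_sq_eq_tsum,
    ← ENNReal.tsum_mul_right]
  refine tsum_congr fun j => ?_
  rw [ENNReal.ofReal_mul (eigenIndex_nonneg hA h ⟨b, j⟩), ENNReal.ofReal_pow (norm_nonneg _),
    ofReal_norm, mul_comm]
  simp only [u, eigenBasis_apply]

end Diagonalization

/-! ### The equality case of Klein's inequality -/

section Klein

/-- The strict tangent line inequality `log x < x - 1` at `x = b / a`. -/
theorem sub_lt_mul_log_sub {a b : ℝ} (ha : 0 < a) (hb : 0 < b) (hab : b ≠ a) :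
    a - b < a * Real.log a - a * Real.log b := by
  have h := Real.log_lt_sub_one_of_pos (div_pos hb ha) (by rwa [ne_eq, div_eq_one_iff_eq ha.ne'])
  rw [Real.log_div hb.ne' ha.ne'] at h
  have h2 := mul_lt_mul_of_pos_left h ha
  rw [mul_sub, mul_sub, mul_div_cancel₀ _ ha.ne'] at h2
  linarith

/-- Klein's inequality for one eigenvector: for a probability distribution `w` on `(0, ∞)` with mean
`s` and with `n = -∑ w_b log b`, one has `a - s ≤ a log a + a n`; equality forces `w` to be
concentrated at `a`. -/
theorem klein_pointwise {w : ℝ → ℝ} {a s n : ℝ} (ha : 0 < a) (hw : ∀ b, 0 ≤ w b)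
    (hpos : ∀ b, w b ≠ 0 → 0 < b) (h1 : HasSum w 1) (hs : HasSum (fun b => w b * b) s)
    (hn : HasSum (fun b => w b * -Real.log b) n) :
    a - s ≤ a * Real.log a + a * n ∧
      (a * Real.log a + a * n = a - s → ∀ b, w b ≠ 0 → b = a) := by
  have hsum : HasSum (fun b => w b * (a * Real.log a - a * Real.log b - (a - b)))
      (a * Real.log a + a * n - (a - s)) := by
    have := ((h1.mul_right (a * Real.log a - a)).add (hn.mul_left a)).add hs
    rw [show a * Real.log a + a * n - (a - s) = 1 * (a * Real.log a - a) + a * n + s by ring]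
    exact this.congr_fun fun b => by ring
  have hnn : ∀ b, 0 ≤ w b * (a * Real.log a - a * Real.log b - (a - b)) := fun b => by
    by_cases hb : w b = 0
    · simp [hb]
    · refine mul_nonneg (hw b) ?_
      rcases eq_or_ne b a with rfl | hab
      · simp
      · exact (sub_pos.2 (sub_lt_mul_log_sub ha (hpos b hb) hab)).le
  refine ⟨sub_nonneg.1 (hsum.nonneg hnn), fun heq b hb => ?_⟩
  rw [heq, sub_self, hasSum_zero_iff_of_nonneg hnn] at hsum
  by_contra hab
  have := congrFun hsum b
  have h2 := sub_lt_mul_log_sub ha (hpos b hb) hab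
  simp only [Pi.zero_apply, mul_eq_zero, hb, false_or] at this
  linarith

variable {K : Type u} [NormedAddCommGroup K] [InnerProductSpace ℂ K] [CompleteSpace K]

theorem apply_eq_zero_of_re_inner_eq_zero {A : K →L[ℂ] K} (hA : 0 ≤ A) {x : K}
    (h : (⟪x, A x⟫_ℂ).re = 0) : A x = 0 := by
  rw [← inner_sqrt_sqrt hA, inner_self_eq_norm_sq_to_K] at h
  have h1 : ‖CFC.sqrt A x‖ ^ 2 = 0 := by
    rw [← h]
    norm_cast
  have h2 : CFC.sqrt A x = 0 := by simpa using h1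
  rw [← CFC.sqrt_mul_sqrt_self A hA, mul_apply_eq_comp, h2, map_zero]

/-- A diagonal entry of `η log η - η log σ` is at least the corresponding entry of `η - σ`, with
equality only if the eigenvector of `η` is one of `σ`, for the same eigenvalue. -/
theorem entropyTerm_ge {η σ : K →L[ℂ] K} (hη : 0 ≤ η) (hηt : IsTraceClass η) (hσ : 0 ≤ σ)
    (hσt : IsTraceClass σ) (htr : (trace σ).re ≤ 1)
    (hker : LinearMap.ker (σ : K →ₗ[ℂ] K) ≤ LinearMap.ker (η : K →ₗ[ℂ] K)) (p : EigenIndex η)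
    (htop : entropyTerm η σ p ≠ ⊤) :
    ∃ τ : ℝ, entropyTerm η σ p = τ ∧
      p.1 - (⟪eigenBasis hη hηt p, σ (eigenBasis hη hηt p)⟫_ℂ).re ≤ τ ∧
      (τ = p.1 - (⟪eigenBasis hη hηt p, σ (eigenBasis hη hηt p)⟫_ℂ).re →
        σ (eigenBasis hη hηt p) = (p.1 : ℂ) • eigenBasis hη hηt p) := by
  have hφη := apply_eigenBasis hη hηt p
  have hφ1 : ‖eigenBasis hη hηt p‖ = 1 := (eigenBasis hη hηt).orthonormal.1 p
  rw [entropyTerm, ← eigenBasis_apply hη hηt p] at htop ⊢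
  set φ := eigenBasis hη hηt p
  obtain ⟨a, j⟩ := p
  simp only at hφη htop ⊢
  rcases (eigenIndex_nonneg hη hηt ⟨a, j⟩).eq_or_lt with h0 | ha
  · simp only at h0
    subst h0
    refine ⟨0, by simp, ?_, fun h => ?_⟩
    · have := re_inner_nonneg hσ φ
      linarith
    · rw [apply_eq_zero_of_re_inner_eq_zero hσ (by linarith)]
      simp
  simp only at ha
  -- the weight at the eigenvalue `0` vanishes because `φ ⟂ ker η ⊇ ker σ`
  have hP0 : (eigen σ 0).starProjection φ = 0 := by
    rw [Submodule.starProjection_apply_eq_zero_iff, Submodule.mem_orthogonal]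
    intro v hv
    have hv0 : σ v = 0 := by simpa using mem_eigen_iff.1 hv
    have hηv : η v = 0 := hker (LinearMap.mem_ker.2 hv0)
    have h2 : ⟪η v, φ⟫_ℂ = ⟪v, η φ⟫_ℂ := isSymmetric_of_nonneg hη v φ
    rw [hηv, inner_zero_left, hφη, inner_smul_right] at h2
    have hac : (a : ℂ) ≠ 0 := by exact_mod_cast ha.ne'
    simpa [hac] using h2.symm
  let w : ℝ → ℝ := fun b => ‖(eigen σ b).starProjection φ‖ ^ 2
  have hw : ∀ b, 0 ≤ w b := fun b => by positivity
  have hwb : ∀ b, w b ≠ 0 → 0 < b ∧ b ≤ 1 := fun b hb => by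
    have hb' : (eigen σ b).starProjection φ ≠ 0 := fun h => hb (by simp [w, h])
    obtain ⟨h1, h2⟩ := nonneg_and_le_of_starProjection_ne_zero hσ hσt hb'
    refine ⟨h1.lt_of_ne fun h => ?_, h2.trans htr⟩
    subst h
    exact hb' hP0
  have hw1 : HasSum w 1 := by
    have := hasSum_norm_starProjection_sq hσ hσt φ
    rwa [hφ1, one_pow] at this
  have hws := hasSum_norm_starProjection_sq_mul hσ hσt φ
  have hterm : ∀ b, 0 ≤ w b * -Real.log b := fun b => by
    by_cases hb : w b = 0
    · simp [hb]
    · exact mul_nonneg (hw b) (neg_nonneg.2 (Real.log_nonpos (hwb b hb).1.le (hwb b hb).2))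
  have hform : negLogForm σ φ = ∑' b, ENNReal.ofReal (w b * -Real.log b) :=
    tsum_congr fun b => (ENNReal.ofReal_mul (hw b)).symm
  have hfin : negLogForm σ φ ≠ ∞ := by
    intro h
    rw [h, ENNReal.mul_top (by simpa using ha)] at htop
    exact htop (EReal.coe_add_top _)
  have hn : HasSum (fun b => w b * -Real.log b) (negLogForm σ φ).toReal :=
    hasSum_of_tsum_ofReal hterm ENNReal.toReal_nonneg
      (by rw [← hform, ENNReal.ofReal_toReal hfin])
  obtain ⟨hle, heq⟩ := klein_pointwise ha hw (fun b hb => (hwb b hb).1) hw1 hws hn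
  refine ⟨a * Real.log a + a * (negLogForm σ φ).toReal, ?_, hle, fun h => ?_⟩
  · rw [EReal.coe_add]
    congr 1
    rw [← ENNReal.ofReal_toReal hfin, ← ENNReal.ofReal_mul ha.le, EReal.coe_ennreal_ofReal,
      max_eq_left (by positivity), ENNReal.toReal_ofReal ENNReal.toReal_nonneg]
  · have h2 := heq h
    have h3 : w a = 1 :=
      (hasSum_single a fun b hb => by_contra fun hne => hb (h2 b hne)).unique hw1
    have h4 : ‖(eigen σ a).starProjection φ‖ = ‖φ‖ := by
      rw [hφ1]
      exact (pow_eq_one_iff_of_nonneg (norm_nonneg _) two_ne_zero).1 h3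
    exact mem_eigen_iff.1 ((Submodule.mem_iff_norm_starProjection _ _).2 h4)

/-- Klein's inequality is strict: states with vanishing relative entropy coincide. -/
theorem eq_of_relEntropy_eq_zero {η σ : K →L[ℂ] K} (hη : 0 ≤ η) (hηt : IsTraceClass η)
    (hηtr : (trace η).re = 1) (hσ : 0 ≤ σ)
    (hσt : IsTraceClass σ) (htr : (trace σ).re ≤ 1) (h : relEntropy η σ = 0) : η = σ := by
  rw [relEntropy] at h
  split_ifs at h with hker
  swap
  · simp at h
  set P := ∑' p : EigenIndex η, (entropyTerm η σ p).toENNReal with hP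
  set N := ∑' p : EigenIndex η, (-entropyTerm η σ p).toENNReal with hN
  -- `⊤ - ⊤ = ⊥` in `EReal`, so neither part of the trace can be infinite
  have hPtop : P ≠ ∞ := by
    intro hPt
    rw [hPt] at h
    rcases eq_or_ne N ∞ with hNt | hNt
    · rw [hNt] at h
      simp at h
    · lift N to ℝ≥0 using hNt with N'
      rw [EReal.coe_ennreal_top, EReal.coe_nnreal_eq_coe_real, EReal.top_sub_coe] at h
      simp at h
  have hNtop : N ≠ ∞ := by
    intro hNt
    rw [hNt] at h
    simp at h
  have hPN : P.toReal - N.toReal = 0 := by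
    have h' := h
    rw [← EReal.coe_ennreal_toReal hPtop, ← EReal.coe_ennreal_toReal hNtop] at h'
    exact_mod_cast h'
  have hterm : ∀ p, entropyTerm η σ p ≠ ⊤ := fun p hp => by
    have := ENNReal.le_tsum (f := fun p : EigenIndex η => (entropyTerm η σ p).toENNReal) p
    rw [hp, EReal.toENNReal_top, top_le_iff] at this
    exact hPtop this
  choose τ hτ hle heq using fun p => entropyTerm_ge hη hηt hσ hσt htr hker p (hterm p)
  have hsum : ∀ f : EigenIndex η → ℝ, ∑' p, ENNReal.ofReal (f p) ≠ ∞ →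
      HasSum (fun p => max (f p) 0) (∑' p, ENNReal.ofReal (f p)).toReal := fun f hf => by
    refine hasSum_of_tsum_ofReal (fun _ => le_max_right _ _) ENNReal.toReal_nonneg ?_
    rw [ENNReal.ofReal_toReal hf]
    exact tsum_congr fun p => by
      rcases le_total (f p) 0 with h0 | h0 <;> simp [h0]
  have hP' : P = ∑' p, ENNReal.ofReal (τ p) :=
    tsum_congr fun p => by rw [hτ, EReal.toENNReal_of_ne_top (EReal.coe_ne_top _), EReal.toReal_coe]
  have hN' : N = ∑' p, ENNReal.ofReal (-τ p) :=
    tsum_congr fun p => by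
      rw [hτ, ← EReal.coe_neg, EReal.toENNReal_of_ne_top (EReal.coe_ne_top _), EReal.toReal_coe]
  have hτsum : HasSum τ 0 := by
    have := (hsum τ (hP' ▸ hPtop)).sub (hsum (fun p => -τ p) (hN' ▸ hNtop))
    rw [← hP', ← hN', hPN] at this
    refine this.congr_fun fun p => ?_
    rcases le_total (τ p) 0 with h0 | h0
    · rw [max_eq_right h0, max_eq_left (by linarith)]; ring
    · rw [max_eq_left h0, max_eq_right (by linarith)]; ring
  let u := eigenBasis hη hηt
  have hgap := hτsum.sub ((hasSum_eigenIndex hη hηt).sub (hasSum_re_trace hσ hσt u))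
  have hgap0 : ∀ p, 0 ≤ τ p - (p.1 - (⟪u p, σ (u p)⟫_ℂ).re) := fun p => sub_nonneg.2 (hle p)
  have hval : 0 - ((trace η).re - (trace σ).re) = 0 :=
    le_antisymm (by linarith) (hgap.nonneg hgap0)
  rw [hval, hasSum_zero_iff_of_nonneg hgap0] at hgap
  refine ContinuousLinearMap.ext_on (s := Set.range u)
    ((Submodule.dense_iff_topologicalClosure_eq_top).2 u.dense_span) ?_
  rintro _ ⟨p, rfl⟩
  have h1 := congrFun hgap p
  simp only [Pi.zero_apply] at h1
  rw [heq p (by linarith), apply_eigenBasis]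

theorem relEntropy_self {η : K →L[ℂ] K} (hη : 0 ≤ η) (hηt : IsTraceClass η)
    (htr : (trace η).re ≤ 1) : relEntropy η η = 0 := by
  have h0 : ∀ p, entropyTerm η η p = 0 := fun p => by
    have hφ1 : ‖(stdBasis (eigen η p.1) p.2 : K)‖ = 1 :=
      (stdBasis (eigen η p.1)).orthonormal.1 p.2
    have hform : negLogForm η (stdBasis (eigen η p.1) p.2 : K) =
        ENNReal.ofReal (-Real.log p.1) := by
      rw [negLogForm, tsum_eq_single p.1]
      · rw [Submodule.starProjection_eq_self_iff.2 (stdBasis (eigen η p.1) p.2).2, hφ1]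
        simp
      · intro b hb
        have : (eigen η b).starProjection (stdBasis (eigen η p.1) p.2 : K) = 0 := by
          rw [Submodule.starProjection_apply_eq_zero_iff, Submodule.mem_orthogonal]
          intro v hv
          exact orthogonalFamily_eigen hη hb ⟨v, hv⟩ (stdBasis (eigen η p.1) p.2)
        simp [this]
    have ha := eigenIndex_nonneg hη hηt p
    have ha1 := (eigenIndex_le hη hηt p).trans htr
    have hlog := Real.log_nonpos ha ha1
    rw [entropyTerm, hform, ← ENNReal.ofReal_mul ha, EReal.coe_ennreal_ofReal,
      max_eq_left (mul_nonneg ha (neg_nonneg.2 hlog)), ← EReal.coe_add, mul_neg, add_neg_cancel,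
      EReal.coe_zero]
  simp [relEntropy, h0]

end Klein

/-! ### Operators with a prescribed Gram kernel -/

section Gram

open scoped ComplexConjugate

/-- A positive semidefinite kernel is the Gram kernel of a family of vectors in a Hilbert space. -/
theorem exists_gram {I : Type v} {N : I → I → ℂ} (hN : ∀ i j, conj (N j i) = N i j)
    (hpos : ∀ v : I →₀ ℂ, 0 ≤ (v.sum fun i w => v.sum fun j w' => conj (N j i * w) * w').re) :
    ∃ (G : Type v) (_ : NormedAddCommGroup G) (_ : InnerProductSpace ℂ G) (_ : CompleteSpace G)
      (Z : I → G), ∀ i j, ⟪Z i, Z j⟫_ℂ = N i j := by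
  let κ : Matrix I I (ℂ →L[ℂ] ℂ) := fun i j => N i j • (1 : ℂ →L[ℂ] ℂ)
  have hκ : κ.PosSemidef := by
    refine ((RKHS.posSemidef_tfae (K := κ)).out 0 2 (by rfl) (by rfl)).2
      (And.intro (Matrix.IsHermitian.ext fun i j => ?_) fun v => ?_)
    · ext
      simp [κ, ← hN i j]
    · refine (hpos v).trans_eq ?_
      simp [κ, mul_comm]
  have : Fact κ.PosSemidef := ⟨hκ⟩
  refine ⟨RKHS.OfKernel κ, inferInstance, inferInstance, inferInstance,
    fun i => RKHS.kerFun (RKHS.OfKernel κ) i (1 : ℂ), fun i j => ?_⟩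
  rw [← RKHS.kernel_inner, RKHS.OfKernel.kernel_ofKernel]
  simp [κ, hN]

variable {I : Type*} {K : Type*} [NormedAddCommGroup K] [InnerProductSpace ℂ K]

theorem clm_ext_hilbertBasis {σ : ℂ →+* ℂ} {E : Type*} [NormedAddCommGroup E] [NormedSpace ℂ E]
    (B : HilbertBasis I ℂ K) {f g : K →SL[σ] E} (h : ∀ i, f (B i) = g (B i)) : f = g := by
  refine ContinuousLinearMap.ext_on (s := Set.range B)
    ((Submodule.dense_iff_topologicalClosure_eq_top).2 B.dense_span) ?_
  rintro _ ⟨i, rfl⟩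
  exact h i

theorem eq_of_inner_hilbertBasis (B : HilbertBasis I ℂ K) {x y : K}
    (h : ∀ i, ⟪B i, x⟫_ℂ = ⟪B i, y⟫_ℂ) : x = y := by
  have h1 := tsum_enorm_inner_sq B (x - y)
  simp only [inner_sub_right, h, sub_self] at h1
  exact sub_eq_zero.1 (by simpa using h1.symm)

theorem clm_eq_of_inner_hilbertBasis (B : HilbertBasis I ℂ K) {X Y : K →L[ℂ] K}
    (h : ∀ i j, ⟪B i, X (B j)⟫_ℂ = ⟪B i, Y (B j)⟫_ℂ) : X = Y :=
  clm_ext_hilbertBasis B fun j => eq_of_inner_hilbertBasis B fun i => h i j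

variable [CompleteSpace K]
variable {G : Type*} [NormedAddCommGroup G] [InnerProductSpace ℂ G] [CompleteSpace G]

/-- A square summable family of vectors is the image of a Hilbert basis under a bounded operator. -/
theorem exists_apply_hilbertBasis_eq (B : HilbertBasis I ℂ K) {Z : I → G}
    (hZ : Summable fun i => ‖Z i‖ ^ 2) : ∃ W : K →L[ℂ] G, ∀ i, W (B i) = Z i := by
  have hle : ∀ z i, ‖⟪Z i, z⟫_ℂ‖ ^ 2 ≤ ‖Z i‖ ^ 2 * ‖z‖ ^ 2 := fun z i => by
    rw [← mul_pow]
    gcongr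
    exact norm_inner_le_norm _ _
  have hs : ∀ z, Summable fun i => ‖⟪Z i, z⟫_ℂ‖ ^ 2 := fun z =>
    Summable.of_nonneg_of_le (fun _ => by positivity) (hle z) (hZ.mul_right _)
  have hex : ∀ z : G, ∃ y : K, ∀ i, ⟪B i, y⟫_ℂ = ⟪Z i, z⟫_ℂ := fun z => by
    refine ⟨B.repr.symm ⟨fun i => ⟪Z i, z⟫_ℂ, memℓp_gen (by simpa using hs z)⟩, fun i => ?_⟩
    rw [← B.repr_apply_apply, LinearIsometryEquiv.apply_symm_apply]
  choose y hy using hex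
  let V : G →ₗ[ℂ] K :=
    { toFun := y
      map_add' := fun z z' => eq_of_inner_hilbertBasis B fun i => by
        simp only [inner_add_right, hy]
      map_smul' := fun c z => eq_of_inner_hilbertBasis B fun i => by
        simp only [inner_smul_right, hy, RingHom.id_apply] }
  let V' : G →L[ℂ] K := V.mkContinuous (√(∑' i, ‖Z i‖ ^ 2)) fun z => by
    refine le_of_sq_le_sq ?_ (by positivity)
    rw [mul_pow, Real.sq_sqrt (tsum_nonneg fun _ => by positivity), ← tsum_mul_right]
    refine hasSum_le (fun i => ?_) (hasSum_norm_inner_sq B _) (hZ.mul_right (‖z‖ ^ 2)).hasSum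
    exact (congrArg (fun c : ℂ => ‖c‖ ^ 2) (hy z i)).trans_le (hle z i)
  refine ⟨ContinuousLinearMap.adjoint V', fun i => ext_inner_right ℂ fun z => ?_⟩
  rw [ContinuousLinearMap.adjoint_inner_left]
  exact hy z i

/-- If the matrix entries of `X` are the Gram kernel of a square summable family `Z`, then `X = W*
W` for the Hilbert-Schmidt operator `W` that maps the basis to `Z`. -/
theorem nonneg_and_isTraceClass_of_gram (B : HilbertBasis I ℂ K) {Z : I → G}
    (hZ : Summable fun i => ‖Z i‖ ^ 2) {X : K →L[ℂ] K}
    (hX : ∀ i j, ⟪B i, X (B j)⟫_ℂ = ⟪Z i, Z j⟫_ℂ) : 0 ≤ X ∧ IsTraceClass X := by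
  obtain ⟨W, hW⟩ := exists_apply_hilbertBasis_eq B hZ
  have hXW : X = (ContinuousLinearMap.adjoint W).comp W :=
    clm_eq_of_inner_hilbertBasis B fun i j => by
      rw [hX, ContinuousLinearMap.comp_apply, ContinuousLinearMap.adjoint_inner_right, hW, hW]
  have h0 : 0 ≤ X := by
    rw [hXW, ContinuousLinearMap.nonneg_iff_isPositive]
    exact ContinuousLinearMap.isPositive_adjoint_comp_self W
  refine ⟨h0, (isTraceClass_iff_of_nonneg h0).2 ((isHilbertSchmidt_sqrt_iff h0 B).2 ?_)⟩
  simp_rw [hX]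
  exact summable_inner_of_summable_norm_sq hZ hZ

end Gram

/-! ### The Hilbert basis of simple tensors -/

section TensorBasis

variable {H : Type u} [NormedAddCommGroup H] [InnerProductSpace ℂ H]

theorem orthonormal_simpleTensor {ι : Type*} {e : ι → H} (he : Orthonormal ℂ e) :
    Orthonormal ℂ fun i : ι × ι => simpleTensor (e i.1) (e i.2) :=
  (he.tmul he).comp_linearIsometry (UniformSpace.Completion.toComplₗᵢ (𝕜 := ℂ) (E := H ⊗[ℂ] H))

/-- The simple tensors of basis vectors form a Hilbert basis of `H ⊗ H`. -/
def tensorBasis {ι : Type*} (e : HilbertBasis ι ℂ H) :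
    HilbertBasis (ι × ι) ℂ (HilbertTensor H) :=
  HilbertBasis.mkOfOrthogonalEqBot (v := fun i => simpleTensor (e i.1) (e i.2))
    (orthonormal_simpleTensor e.orthonormal)
    (by
      rw [Submodule.eq_bot_iff]
      intro x hx
      rw [Submodule.mem_orthogonal'] at hx
      have h0 : ∀ k l, ⟪x, simpleTensor (e k) (e l)⟫_ℂ = 0 := fun k l =>
        hx _ (Submodule.subset_span ⟨(k, l), rfl⟩)
      let F : H →L[ℂ] H →L[ℂ] ℂ :=
        (ContinuousLinearMap.compL ℂ H (H ⊗[ℂ] H) ℂ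
          ((innerSL ℂ x).comp UniformSpace.Completion.toComplL)).comp (TensorProduct.mkL ℂ H H)
      have hF : ∀ u v, F u v = ⟪x, simpleTensor u v⟫_ℂ := fun u v => rfl
      have hF0 : F = 0 := clm_ext_hilbertBasis e fun k => clm_ext_hilbertBasis e fun l => by
        rw [hF, h0]
        rfl
      refine (UniformSpace.Completion.denseRange_coe (α := H ⊗[ℂ] H)).eq_zero_of_inner_right ℂ
        fun t => ?_
      rw [← inner_conj_symm]
      have : ⟪x, (t : HilbertTensor H)⟫_ℂ = 0 := by
        induction t using TensorProduct.induction_on with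
        | zero => rw [UniformSpace.Completion.coe_zero, inner_zero_right]
        | tmul u v =>
          change ⟪x, simpleTensor u v⟫_ℂ = 0
          rw [← hF, hF0]
          rfl
        | add s t hs ht => rw [UniformSpace.Completion.coe_add, inner_add_right, hs, ht, add_zero]
      rw [this, map_zero])

theorem tensorBasis_apply {ι : Type*} (e : HilbertBasis ι ℂ H) (i : ι × ι) :
    tensorBasis e i = simpleTensor (e i.1) (e i.2) :=
  congrFun (HilbertBasis.coe_mkOfOrthogonalEqBot _ _) i

end TensorBasis

/-! ### The Choi-Jamiolkowski operator of a completely positive map -/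

section ChoiOperator

open scoped ComplexConjugate

variable {H : Type u} [NormedAddCommGroup H] [InnerProductSpace ℂ H] [CompleteSpace H]

/-- Complete positivity applied to the positive matrix `(|f_i⟩⟨f_j|)`, which is `n⁻¹` times its own
square when the `n` vectors `f_i` are unit vectors. -/
theorem IsCompletelyPositive.exists_eq_sum {Φ : (H →L[ℂ] H) →L[ℂ] (H →L[ℂ] H)}
    (hΦ : IsCompletelyPositive Φ) {n : Type*} [Fintype n] (f : n → H) (hf : ∀ i, ‖f i‖ = 1) :
    ∃ Y : n → n → (H →L[ℂ] H), ∀ i j, Φ (rankOne ℂ (f i) (f j)) = ∑ k, star (Y k i) * Y k j := by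
  obtain ⟨Ψ, hΨ⟩ := hΦ
  let c : ℂ := ((√(Fintype.card n))⁻¹ : ℝ)
  let R : CStarMatrix n n (H →L[ℂ] H) := CStarMatrix.ofMatrix fun i j => c • rankOne ℂ (f i) (f j)
  have hM : 0 ≤ (CStarMatrix.ofMatrix fun i j => rankOne ℂ (f i) (f j) :
      CStarMatrix n n (H →L[ℂ] H)) := by
    have : (CStarMatrix.ofMatrix fun i j => rankOne ℂ (f i) (f j) :
      CStarMatrix n n (H →L[ℂ] H)) = star R * R := by
      ext1 i j
      have : Nonempty n := ⟨i⟩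
      have hn : (Fintype.card n : ℝ) ≠ 0 := by exact_mod_cast Fintype.card_ne_zero
      have hc : (Fintype.card n : ℂ) * (c * c) = 1 := by
        simp only [c]
        rw [← Complex.ofReal_mul, ← mul_inv, Real.mul_self_sqrt (by positivity)]
        exact_mod_cast mul_inv_cancel₀ hn
      have hterm : ∀ k, star (R k i) * R k j = (c * c) • rankOne ℂ (f i) (f j) := fun k => by
        have hR : ∀ k j, R k j = c • rankOne ℂ (f k) (f j) := fun k j => rfl
        have hcc : star c = c := Complex.conj_ofReal _
        rw [hR, hR, star_smul, hcc, smul_mul_smul_comm, ContinuousLinearMap.star_eq_adjoint,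
          InnerProductSpace.adjoint_rankOne]
        congr 1
        ext x
        rw [mul_apply_eq_comp, InnerProductSpace.rankOne_apply, InnerProductSpace.rankOne_apply,
          InnerProductSpace.rankOne_apply, inner_smul_right,
          inner_self_eq_one_of_norm_eq_one (hf k), mul_one]
      rw [CStarMatrix.mul_apply]
      simp only [CStarMatrix.star_apply, hterm, Finset.sum_const, Finset.card_univ]
      rw [← Nat.cast_smul_eq_nsmul ℂ, smul_smul, hc, one_smul]
      rfl
    rw [this]
    exact star_mul_self_nonneg R
  obtain ⟨Y, hY⟩ := exists_eq_star_mul_self_of_nonneg (Ψ.map_cstarMatrix_nonneg _ hM)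
  refine ⟨fun k i => Y k i, fun i j => ?_⟩
  have := congrFun (congrFun hY i) j
  rw [← hΨ]
  exact this

theorem IsCompletelyPositive.mono {Φ : (H →L[ℂ] H) →L[ℂ] (H →L[ℂ] H)}
    (hΦ : IsCompletelyPositive Φ) {x y : H →L[ℂ] H} (h : x ≤ y) : Φ x ≤ Φ y := by
  obtain ⟨Ψ, hΨ⟩ := hΦ
  rw [← hΨ, ← hΨ]
  exact OrderHomClass.mono Ψ h

theorem IsCompletelyPositive.map_rankOne_self_nonneg {Φ : (H →L[ℂ] H) →L[ℂ] (H →L[ℂ] H)}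
    (hΦ : IsCompletelyPositive Φ) (u : H) : 0 ≤ Φ (rankOne ℂ u u) := by
  have := hΦ.mono ((ContinuousLinearMap.nonneg_iff_isPositive _).2
    (InnerProductSpace.isPositive_rankOne_self (𝕜 := ℂ) u))
  rwa [map_zero] at this

theorem IsPredual.inner_apply {Φ : (H →L[ℂ] H) →L[ℂ] (H →L[ℂ] H)}
    {Φs : TraceClass H → TraceClass H} (h : IsPredual Φ Φs) (σ : TraceClass H) (u v : H) :
    ⟪v, (Φs σ : H →L[ℂ] H) u⟫_ℂ = trace (σ.1 * Φ (rankOne ℂ u v)) := by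
  rw [← h, trace_mul_rankOne]

theorem predual_eq_of_rankOne {Φ Ψ : (H →L[ℂ] H) →L[ℂ] (H →L[ℂ] H)}
    {Φs Ψs : TraceClass H → TraceClass H} (hΦ : IsPredual Φ Φs) (hΨ : IsPredual Ψ Ψs)
    (h : ∀ u v : H, Φ (rankOne ℂ u v) = Ψ (rankOne ℂ u v)) : Φs = Ψs := by
  funext σ
  apply Subtype.ext
  ext u
  refine ext_inner_left ℂ fun v => ?_
  rw [hΦ.inner_apply, hΨ.inner_apply, h]

/-- Normal maps are determined by their values on rank one operators. -/
theorem eq_of_rankOne {Φ Ψ : (H →L[ℂ] H) →L[ℂ] (H →L[ℂ] H)}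
    {Φs Ψs : TraceClass H → TraceClass H} (hΦ : IsPredual Φ Φs) (hΨ : IsPredual Ψ Ψs)
    (h : ∀ u v : H, Φ (rankOne ℂ u v) = Ψ (rankOne ℂ u v)) : Φ = Ψ := by
  ext x u
  refine ext_inner_left ℂ fun v => ?_
  have h1 := hΦ ⟨rankOne ℂ u v, isTraceClass_rankOne u v⟩ x
  rw [predual_eq_of_rankOne hΦ hΨ h, hΨ, trace_rankOne_mul, trace_rankOne_mul] at h1
  exact h1.symm

/-- The matrix entries of the Choi-Jamiolkowski operator in terms of the Heisenberg picture map: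
`⟨ρ^½ e_k', Φ(|e_l'⟩⟨e_l|) ρ^½ e_k⟩` at row `(k, l)` and column `(k', l')`. -/
def choiKernel {ι : Type*} (e : HilbertBasis ι ℂ H) (ρ : H →L[ℂ] H)
    (Φ : (H →L[ℂ] H) →L[ℂ] (H →L[ℂ] H)) (i j : ι × ι) : ℂ :=
  ⟪CFC.sqrt ρ (e j.1), Φ (rankOne ℂ (e j.2) (e i.2)) (CFC.sqrt ρ (e i.1))⟫_ℂ

variable {ι : Type*} (e : HilbertBasis ι ℂ H) {ρ : H →L[ℂ] H}
  {Φ : (H →L[ℂ] H) →L[ℂ] (H →L[ℂ] H)} {Φs : TraceClass H → TraceClass H}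

theorem isChoiJamiolkowski_iff (h : IsPredual Φ Φs)
    {J : HilbertTensor H →L[ℂ] HilbertTensor H} :
    IsChoiJamiolkowski e ρ Φs J ↔
      ∀ i j, ⟪tensorBasis e i, J (tensorBasis e j)⟫_ℂ = choiKernel e ρ Φ i j := by
  simp only [IsChoiJamiolkowski, h.inner_apply, trace_rankOne_mul, tensorBasis_apply, choiKernel]
  exact ⟨fun h i j => h i.1 i.2 j.1 j.2, fun h k l k' l' => h (k, l) (k', l')⟩

/-- Complete positivity makes the Choi kernel a Gram kernel. -/
theorem IsCompletelyPositive.exists_gram {ι : Type v} (e : HilbertBasis ι ℂ H)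
    (hΦ : IsCompletelyPositive Φ) :
    ∃ (G : Type v) (_ : NormedAddCommGroup G) (_ : InnerProductSpace ℂ G) (_ : CompleteSpace G)
      (Z : ι × ι → G), ∀ i j, ⟪Z i, Z j⟫_ℂ = choiKernel e ρ Φ i j := by
  have he : ∀ i, ‖e i‖ = 1 := e.orthonormal.1
  refine QuantumMarkov.exists_gram (fun i j => ?_) fun v => ?_
  · obtain ⟨Y, hY⟩ := hΦ.exists_eq_sum (n := Fin 2) ![e j.2, e i.2] (by
      intro k; fin_cases k <;> simp [he])
    have h1 := hY 0 1
    have h2 := hY 1 0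
    have h3 : star (Φ (rankOne ℂ (e j.2) (e i.2))) = Φ (rankOne ℂ (e i.2) (e j.2)) := by
      simp only [Matrix.cons_val_zero, Matrix.cons_val_one] at h1 h2
      rw [h1, h2]
      simp
    rw [choiKernel, choiKernel, inner_conj_symm, ← h3, ContinuousLinearMap.star_eq_adjoint,
      ContinuousLinearMap.adjoint_inner_left]
  · obtain ⟨Y, hY⟩ := hΦ.exists_eq_sum (n := v.support) (fun i => e i.1.2) fun i => he _
    -- the entries are Gram entries in the opposite order, so the coefficients enter conjugated
    let z : v.support → v.support → H := fun k i => conj (v i.1) • Y k i (CFC.sqrt ρ (e i.1.1))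
    have hz : (v.sum fun i w => v.sum fun j w' => conj (choiKernel e ρ Φ j i * w) * w') =
        ∑ k, ⟪∑ j, z k j, ∑ i, z k i⟫_ℂ := by
      have hterm : ∀ i j : v.support, conj (choiKernel e ρ Φ j i * v i) * v j =
          ∑ k, ⟪z k j, z k i⟫_ℂ := fun i j => by
        simp only [choiKernel, hY i j, sum_apply, inner_sum, Finset.sum_mul,
          map_sum]
        refine Finset.sum_congr rfl fun k _ => ?_
        rw [mul_apply_eq_comp, ContinuousLinearMap.star_eq_adjoint,
          ContinuousLinearMap.adjoint_inner_right, map_mul, inner_conj_symm, inner_smul_left,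
          inner_smul_right, Complex.conj_conj]
        ring
      simp only [Finsupp.sum]
      rw [← Finset.sum_coe_sort]
      simp_rw [← Finset.sum_coe_sort v.support fun j => conj (choiKernel e ρ Φ j _ * v _) * v j,
        hterm, inner_sum, sum_inner]
      simp_rw [Finset.sum_comm (s := Finset.univ) (f := fun j k => ⟪z k j, z k _⟫_ℂ)]
      rw [Finset.sum_comm]
    rw [hz, Complex.re_sum]
    exact Finset.sum_nonneg fun k _ => inner_self_nonneg (𝕜 := ℂ)

/-- Bessel's inequality as an operator inequality. -/
theorem sum_rankOne_le_one (F : Finset ι) : ∑ l ∈ F, rankOne ℂ (e l) (e l) ≤ 1 := by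
  rw [← sub_nonneg, ContinuousLinearMap.nonneg_iff_isPositive, ContinuousLinearMap.isPositive_def']
  refine ⟨(IsSelfAdjoint.one _).sub (isSelfAdjoint_sum _ fun l _ => ?_), fun x => ?_⟩
  · exact ((ContinuousLinearMap.nonneg_iff_isPositive _).2
      (InnerProductSpace.isPositive_rankOne_self (e l))).isSelfAdjoint
  · have h := e.orthonormal.sum_inner_products_le x (s := F)
    have h1 : ∀ l, RCLike.re ⟪rankOne ℂ (e l) (e l) x, x⟫_ℂ = ‖⟪e l, x⟫_ℂ‖ ^ 2 := fun l => by
      rw [InnerProductSpace.rankOne_apply, inner_smul_left, RCLike.conj_mul]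
      norm_cast
    rw [ContinuousLinearMap.reApplyInnerSelf_apply, sub_apply, inner_sub_left, map_sub, sum_apply,
      sum_inner, map_sum]
    simp only [h1]
    rw [one_apply_eq_self, inner_self_eq_norm_sq]
    linarith

theorem tsum_ofReal_inner_le (hΦ : IsCompletelyPositive Φ) (h1 : Φ 1 = 1) (w : H) :
    ∑' l, ENNReal.ofReal (⟪w, Φ (rankOne ℂ (e l) (e l)) w⟫_ℂ).re ≤ ENNReal.ofReal (‖w‖ ^ 2) := by
  have h0 : ∀ l, 0 ≤ Φ (rankOne ℂ (e l) (e l)) := fun l => hΦ.map_rankOne_self_nonneg (e l)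
  rw [ENNReal.tsum_eq_iSup_sum]
  refine iSup_le fun F => ?_
  rw [← ENNReal.ofReal_sum_of_nonneg fun l _ => re_inner_nonneg (h0 l) w]
  refine ENNReal.ofReal_le_ofReal ?_
  have h2 := hΦ.mono (sum_rankOne_le_one e F)
  rw [h1, ← sub_nonneg, map_sum] at h2
  have h3 := re_inner_nonneg h2 w
  rw [sub_apply, inner_sub_right, Complex.sub_re, sum_apply, inner_sum, Complex.re_sum,
    one_apply_eq_self] at h3
  have h4 : (⟪w, w⟫_ℂ).re = ‖w‖ ^ 2 := inner_self_eq_norm_sq (𝕜 := ℂ) w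
  linarith

/-- For a unital completely positive map the Choi kernel has trace at most one. -/
theorem tsum_choiKernel_le (hρ : IsState ρ) (hΦ : IsCompletelyPositive Φ) (h1 : Φ 1 = 1) :
    ∑' i, ENNReal.ofReal (choiKernel e ρ Φ i i).re ≤ 1 := by
  obtain ⟨hρ0, hρt, hρ1⟩ := hρ
  have h := hasSum_re_trace hρ0 hρt e
  have h2 : ∀ k, ENNReal.ofReal (‖CFC.sqrt ρ (e k)‖ ^ 2) =
      ENNReal.ofReal (⟪e k, ρ (e k)⟫_ℂ).re := fun k => by
    rw [← inner_sqrt_sqrt hρ0]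
    exact congrArg _ (inner_self_eq_norm_sq (𝕜 := ℂ) _).symm
  rw [ENNReal.tsum_prod (f := fun k l => ENNReal.ofReal (choiKernel e ρ Φ (k, l) (k, l)).re)]
  calc _ ≤ ∑' k, ENNReal.ofReal (‖CFC.sqrt ρ (e k)‖ ^ 2) :=
        ENNReal.tsum_le_tsum fun k => tsum_ofReal_inner_le e hΦ h1 _
    _ = 1 := by
        simp_rw [h2]
        rw [← ENNReal.ofReal_tsum_of_nonneg (fun k => re_inner_nonneg hρ0 _) h.summable,
          h.tsum_eq, hρ1]
        simp

/-- If `Φ` preserves the state `ρ`, then the Choi kernel has trace `∑_l tr(ρ Φ(|e_l⟩⟨e_l|)) = 1`. -/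
theorem tsum_choiKernel_eq (hρ : IsState ρ) (hΦ : IsCompletelyPositive Φ)
    (hinv : ∀ x, trace (ρ * Φ x) = trace (ρ * x)) :
    ∑' i, ENNReal.ofReal (choiKernel e ρ Φ i i).re = 1 := by
  obtain ⟨hρ0, hρt, hρ1⟩ := hρ
  have hs := (isTraceClass_iff_of_nonneg hρ0).1 hρt
  have h0 : ∀ l, 0 ≤ Φ (rankOne ℂ (e l) (e l)) := fun l => hΦ.map_rankOne_self_nonneg (e l)
  rw [ENNReal.tsum_prod (f := fun k l => ENNReal.ofReal (choiKernel e ρ Φ (k, l) (k, l)).re),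
    ENNReal.tsum_comm]
  have h1 : ∀ l, ∑' k, ENNReal.ofReal (choiKernel e ρ Φ (k, l) (k, l)).re =
      ENNReal.ofReal (⟪e l, ρ (e l)⟫_ℂ).re := fun l => by
    set X := Φ (rankOne ℂ (e l) (e l)) with hX
    have hsum : Summable fun k => ⟪CFC.sqrt ρ (e k), X (CFC.sqrt ρ (e k))⟫_ℂ :=
      summable_inner_of_summable_norm_sq (hs.summable e) ((hs.mul_left X).summable e)
    have htr : ∑' k, ⟪CFC.sqrt ρ (e k), X (CFC.sqrt ρ (e k))⟫_ℂ = ⟪e l, ρ (e l)⟫_ℂ := by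
      rw [← trace_mul_rankOne, ← hinv, ← hX, ← CFC.sqrt_mul_sqrt_self ρ hρ0, mul_assoc,
        trace_mul_eq_tsum hs (hs.mul_right X) e, CFC.sqrt_mul_sqrt_self ρ hρ0]
      refine tsum_congr fun k => ?_
      rw [mul_apply_eq_comp, inner_sqrt_right]
    rw [← htr, Complex.re_tsum hsum]
    exact (ENNReal.ofReal_tsum_of_nonneg (fun k => re_inner_nonneg (h0 l) _)
      (Complex.hasSum_re hsum.hasSum).summable).symm
  have h := hasSum_re_trace hρ0 hρt e
  simp_rw [h1]
  rw [← ENNReal.ofReal_tsum_of_nonneg (fun k => re_inner_nonneg hρ0 _) h.summable, h.tsum_eq, hρ1]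
  simp

/-- The `ρ`-Choi-Jamiolkowski operator of a unital completely positive map exists and is positive
and trace class. -/
theorem choiJamiolkowski_spec (hρ : IsState ρ) (hΦ : IsCompletelyPositive Φ) (h1 : Φ 1 = 1)
    (hΦs : IsPredual Φ Φs) :
    IsChoiJamiolkowski e ρ Φs (choiJamiolkowski e ρ Φs) ∧ 0 ≤ choiJamiolkowski e ρ Φs ∧
      IsTraceClass (choiJamiolkowski e ρ Φs) ∧
      ENNReal.ofReal (trace (choiJamiolkowski e ρ Φs)).re =
        ∑' i, ENNReal.ofReal (choiKernel e ρ Φ i i).re := by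
  obtain ⟨G, _, _, _, Z, hZ⟩ := hΦ.exists_gram (ρ := ρ) e
  have hdiag : ∀ i, (choiKernel e ρ Φ i i).re = ‖Z i‖ ^ 2 := fun i => by
    rw [← hZ]
    exact inner_self_eq_norm_sq (𝕜 := ℂ) _
  have hZs : Summable fun i => ‖Z i‖ ^ 2 := by
    rw [summable_norm_sq_iff]
    have h := tsum_choiKernel_le e hρ hΦ h1
    simp_rw [hdiag, ENNReal.ofReal_pow (norm_nonneg _), ofReal_norm] at h
    exact ne_top_of_le_ne_top ENNReal.one_ne_top h
  have hex : ∃ J, IsChoiJamiolkowski e ρ Φs J := by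
    obtain ⟨W, hW⟩ := exists_apply_hilbertBasis_eq (tensorBasis e) hZs
    refine ⟨(ContinuousLinearMap.adjoint W).comp W,
      (isChoiJamiolkowski_iff e hΦs).2 fun i j => ?_⟩
    rw [ContinuousLinearMap.comp_apply, ContinuousLinearMap.adjoint_inner_right, hW, hW, hZ]
  have hJ : IsChoiJamiolkowski e ρ Φs (choiJamiolkowski e ρ Φs) := by
    rw [choiJamiolkowski, dif_pos hex]
    exact hex.choose_spec
  have hent := (isChoiJamiolkowski_iff e hΦs).1 hJ
  obtain ⟨hJ0, hJt⟩ := nonneg_and_isTraceClass_of_gram (tensorBasis e) hZs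
    fun i j => (hent i j).trans (hZ i j).symm
  refine ⟨hJ, hJ0, hJt, ?_⟩
  have h := hasSum_re_trace hJ0 hJt (tensorBasis e)
  simp_rw [hent] at h
  rw [← h.tsum_eq, ENNReal.ofReal_tsum_of_nonneg (fun i => ?_) h.summable]
  rw [hdiag]
  positivity

/-- The `ρ`-Choi-Jamiolkowski operator determines the map: the range of `ρ^½` is dense and normal
maps are determined by their values on rank one operators. -/
theorem eq_of_choiJamiolkowski {Ψ : (H →L[ℂ] H) →L[ℂ] (H →L[ℂ] H)}
    {Ψs : TraceClass H → TraceClass H} (hrange : DenseRange (CFC.sqrt ρ : H →L[ℂ] H))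
    (hΦ : IsPredual Φ Φs) (hΨ : IsPredual Ψ Ψs) {J : HilbertTensor H →L[ℂ] HilbertTensor H}
    (h1 : IsChoiJamiolkowski e ρ Φs J) (h2 : IsChoiJamiolkowski e ρ Ψs J) : Φ = Ψ := by
  rw [isChoiJamiolkowski_iff e hΦ] at h1
  rw [isChoiJamiolkowski_iff e hΨ] at h2
  have hbasis : ∀ l l', Φ (rankOne ℂ (e l) (e l')) = Ψ (rankOne ℂ (e l) (e l')) := fun l l' => by
    refine eq_of_inner_denseRange hrange fun u v => ?_
    have hS : CFC.sqrt ρ * Φ (rankOne ℂ (e l) (e l')) * CFC.sqrt ρ =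
        CFC.sqrt ρ * Ψ (rankOne ℂ (e l) (e l')) * CFC.sqrt ρ := by
      refine clm_eq_of_inner_hilbertBasis e fun k k' => ?_
      have := (h1 (k', l') (k, l)).symm.trans (h2 (k', l') (k, l))
      simp only [choiKernel] at this
      simp only [mul_apply_eq_comp]
      rwa [inner_sqrt_right, inner_sqrt_right]
    have h3 := congrArg (fun X : H →L[ℂ] H => ⟪u, X v⟫_ℂ) hS
    simp only [mul_apply_eq_comp] at h3
    rwa [inner_sqrt_right, inner_sqrt_right] at h3
  refine eq_of_rankOne hΦ hΨ fun u v => ?_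
  have h3 : ∀ u l', Φ (rankOne ℂ u (e l')) = Ψ (rankOne ℂ u (e l')) := fun u l' => by
    have := clm_ext_hilbertBasis e (f := Φ.comp ((rankOne ℂ).flip (e l')))
      (g := Ψ.comp ((rankOne ℂ).flip (e l'))) fun l => hbasis l l'
    exact congrArg (fun f : H →L[ℂ] (H →L[ℂ] H) => f u) this
  have := clm_ext_hilbertBasis e (f := Φ.comp (rankOne ℂ u)) (g := Ψ.comp (rankOne ℂ u)) (h3 u)
  exact congrArg (fun f : H →L⋆[ℂ] (H →L[ℂ] H) => f v) this

end ChoiOperator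

/-! ### Detailed balance and entropy production -/

section EntropyProduction

variable {H : Type u} [NormedAddCommGroup H] [InnerProductSpace ℂ H] [CompleteSpace H]

theorem QMS.isPredual (T : QMS H) (t : ℝ≥0) : IsPredual (T.map t) (T.predual t) :=
  (T.normal t).choose_spec

/-- The relative entropy of the Choi-Jamiolkowski operators vanishes exactly when the maps agree. -/
theorem choiEntropy_eq_zero_iff {ι : Type*} (e : HilbertBasis ι ℂ H) {ρ : H →L[ℂ] H}
    (hρ : IsState ρ) (hrange : DenseRange (CFC.sqrt ρ : H →L[ℂ] H)) {T TΘ : QMS H}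
    (hinv : IsInvariantState ρ T) (t : ℝ≥0) :
    choiEntropy e ρ T TΘ t = 0 ↔ T.map t = TΘ.map t := by
  obtain ⟨hJ, hJ0, hJt, htr⟩ := choiJamiolkowski_spec e hρ (T.completelyPositive t) (T.unital t)
    (T.isPredual t)
  obtain ⟨hJ', hJ0', hJt', htr'⟩ := choiJamiolkowski_spec e hρ (TΘ.completelyPositive t)
    (TΘ.unital t) (TΘ.isPredual t)
  rw [tsum_choiKernel_eq e hρ (T.completelyPositive t) (hinv t), ENNReal.ofReal_eq_one] at htr
  have hle := htr'.trans_le (tsum_choiKernel_le e hρ (TΘ.completelyPositive t) (TΘ.unital t))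
  rw [ENNReal.ofReal_le_one] at hle
  constructor
  · intro h
    have hJJ := eq_of_relEntropy_eq_zero hJ0 hJt htr hJ0' hJt' hle h
    rw [← hJJ] at hJ'
    exact eq_of_choiJamiolkowski e hrange (T.isPredual t) (TΘ.isPredual t) hJ hJ'
  · intro h
    rw [choiEntropy, predual_eq_of_rankOne (TΘ.isPredual t) (T.isPredual t) fun u v => by rw [h]]
    exact relEntropy_self hJ0 hJt htr.le

end EntropyProduction

end QuantumMarkov

end

theorem mainTheorem4 {H : Type*} [NormedAddCommGroup H] [InnerProductSpace ℂ H] [CompleteSpace H]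
    [TopologicalSpace.SeparableSpace H]
    (θ : H ≃ₗᵢ⋆[ℂ] H) (hθ : ∀ u, θ (θ u) = u)
    {ι : Type*} (e : HilbertBasis ι ℂ H)
    (ρ : H →L[ℂ] H) (hρ : IsState ρ) (hfaithful : IsFaithful ρ)
    (hrange : DenseRange (CFC.sqrt ρ : H →L[ℂ] H))
    (T TΘ : QMS H) (hinv : IsInvariantState ρ T) (hadj : IsThetaKMSAdjoint θ ρ T TΘ) :
    (ThetaSQDB θ ρ T ↔
      ∀ t : ℝ≥0, relEntropy (choiJamiolkowski e ρ (T.predual t))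
        (choiJamiolkowski e ρ (TΘ.predual t)) = 0) ∧
    (ThetaSQDB θ ρ T → IsEntropyProductionRate e ρ T TΘ 0) := by
  have hiff : ThetaSQDB θ ρ T ↔ ∀ t, choiEntropy e ρ T TΘ t = 0 :=
    (thetaSQDB_iff_map_eq hθ hrange hadj).trans
      (forall_congr' fun t => (choiEntropy_eq_zero_iff e hρ hrange hinv t).symm)
  refine ⟨hiff, fun h => ?_⟩
  have h0 := hiff.1 h
  refine ⟨fun t => by simp [h0], ?_⟩
  simp only [h0, EReal.toReal_zero]
  exact hasDerivWithinAt_const _ _ _
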